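/- Let $\hbar,m,T>0$. Let $U\in C_b^\infty(\mathbb R^3_x\times\mathbb R_t)$ be real-valued (smooth, with all derivatives, including the one of order zero, bounded), and let $B=(B_1,B_2,B_3)$ and $K=(K_1,K_2,K_3)$ be real time-dependent vector fields on $\mathbb R^3$ with $B_i\in C([0,T],W^{1,\infty}(\mathbb R^3))$ and $K_i\in C([0,T],W^{2,\infty}(\mathbb R^3))$ for $i=1,2,3$. Fix $t\in[0,T]$ and consider the matrix-valued symbol $$\mathcal H(x,p)=\Big(\frac{|p|^2}{2m}+U(x,t)\Big)\sigma_0+\hbar\,\big(p\wedge K(x,t)-B(x,t)\big)\cdot\sigma ,\qquad x,p\in\mathbb R^3,$$ where $\sigma=(\sigma_1,\sigma_2,\sigma_3)$ are the Pauli matrices, $\sigma_0$ is the $2\times2$ identity matrix and $\wedge$ is the vector product. Then the Weyl quantization $$(\mathrm{Op}(\mathcal H)\psi)(x)=\frac1{(2\pi\hbar)^3}\int_{\mathbb R^3}\int_{\mathbb R^3}\mathcal H\Big(\frac{x+y}2,p\Big)\psi(y)\,e^{\frac i\hbar (x-y)\cdot p}\,dy\,dp ,$$ understood in the sense of distributions,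 that is, $$\int_{\mathbb R^3}\langle\chi(x),(\mathrm{Op}(\mathcal H)\psi)(x)\rangle\,dx=\frac1{(2\pi\hbar)^3}\int_{\mathbb R^3_p}\Big(\int_{\mathbb R^3_x\times\mathbb R^3_y}\Big\langle\chi(x),\mathcal H\Big(\frac{x+y}2,p\Big)\psi(y)\Big\rangle e^{\frac i\hbar (x-y)\cdot p}\,dx\,dy\Big)dp\quad\text{for all }\chi\in C_0^\infty(\mathbb R^3;\mathbb C^2)$$ (the inner integral and the integral over $p$ both converging absolutely), is a well-defined linear operator in $L^2(\mathbb R^3;\mathbb C^2)$ with domain $C_0^\infty(\mathbb R^3;\mathbb C^2)$, and it is essentially self-adjoint: it is densely defined and symmetric, and its closure is self-adjoint. -/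

import Mathlib

open MeasureTheory Filter Topology
open scoped ContDiff ENNReal Matrix

noncomputable section

namespace Rashba

/-- Physical space `ℝ³` with the Euclidean norm (also used as momentum space). -/
abbrev E3 : Type := EuclideanSpace ℝ (Fin 3)

/-- The spin space `ℂ²` with its Hermitian inner product. -/
abbrev Spin : Type := EuclideanSpace ℂ (Fin 2)

/-- The Hilbert space `L²(ℝ³; ℂ²)`. -/
abbrev L2Spin : Type := Lp Spin 2 (volume : Measure E3)

/-! ### Sobolev spaces `W^{k,∞}(ℝ³)` -/

/-- `g` is the weak derivative `∂_{α 0} ⋯ ∂_{α (j-1)} f` of `f` on `ℝ³`. For `j = 0` this says that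
`g = f` almost everywhere. -/
def HasWeakDeriv {j : ℕ} (α : Fin j → Fin 3) (f g : E3 → ℝ) : Prop :=
  LocallyIntegrable f volume ∧ LocallyIntegrable g volume ∧
    ∀ φ : E3 → ℝ, ContDiff ℝ ∞ φ → HasCompactSupport φ →
      ∫ x, f x * iteratedFDeriv ℝ j φ x (fun i => EuclideanSpace.single (α i) (1 : ℝ)) =
        (-1 : ℝ) ^ j * ∫ x, g x * φ x

/-- `f ∈ W^{k,∞}(ℝ³)`: all weak derivatives of order at most `k` exist and are essentially
bounded. -/
def MemWInfty (k : ℕ) (f : E3 → ℝ) : Prop :=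
  ∀ j ≤ k, ∀ α : Fin j → Fin 3, ∃ g : E3 → ℝ, HasWeakDeriv α f g ∧ MemLp g ∞ volume

/-- The norm of `W^{k,∞}(ℝ³)`: the maximum, over the weak derivatives of order at most `k`, of their
essential suprema (a weak derivative is unique up to null sets, so the infimum over `g` only selects
it; the value is `∞` if it does not exist). -/
def wInftyNorm (k : ℕ) (f : E3 → ℝ) : ℝ≥0∞ :=
  ⨆ (j : ℕ) (_ : j ≤ k) (α : Fin j → Fin 3),
    ⨅ (g : E3 → ℝ) (_ : HasWeakDeriv α f g), eLpNorm g ∞ volume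

/-- `F ∈ C([0,T], W^{k,∞}(ℝ³))`. -/
def MemCWInfty (T : ℝ) (k : ℕ) (F : ℝ → E3 → ℝ) : Prop :=
  (∀ t ∈ Set.Icc 0 T, MemWInfty k (F t)) ∧
    ∀ t ∈ Set.Icc 0 T,
      Tendsto (fun s => wInftyNorm k (F s - F t)) (𝓝[Set.Icc 0 T] t) (𝓝 0)

/-- `U ∈ C_b^∞(ℝ³ × ℝ)`: smooth, with every derivative (of order zero too) bounded. -/
def MemCbInfty (U : E3 × ℝ → ℝ) : Prop :=
  ContDiff ℝ ∞ U ∧ ∀ n : ℕ, ∃ C : ℝ, ∀ z, ‖iteratedFDeriv ℝ n U z‖ ≤ C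

/-- The assumption on the potential energy `U(x,t)`, the magnetic field `B(t)(x)` and the Rashba
field `K(t)(x)`. -/
structure FieldAssumption (T : ℝ) (U : E3 × ℝ → ℝ) (B K : ℝ → E3 → Fin 3 → ℝ) : Prop where
  potential : MemCbInfty U
  magnetic : ∀ i, MemCWInfty T 1 (fun t x => B t x i)
  rashba : ∀ i, MemCWInfty T 2 (fun t x => K t x i)

/-! ### The Hamiltonian symbol -/

/-- The Pauli matrices `σ₁, σ₂, σ₃`. -/
def pauli : Fin 3 → Matrix (Fin 2) (Fin 2) ℂ :=
  ![!![0, 1; 1, 0], !![0, -Complex.I; Complex.I, 0], !![1, 0; 0, -1]]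

/-- `v · σ` for a real vector `v`. -/
def dotPauli (v : Fin 3 → ℝ) : Matrix (Fin 2) (Fin 2) ℂ :=
  ∑ i, (v i : ℂ) • pauli i

/-- The symbol `p² / 2m + U(x) + ħ (p ∧ K(x) - B(x)) · σ` (the scalar part multiplies the identity
matrix). -/
def hamiltonianSymbol (hbar m : ℝ) (U : E3 → ℝ) (B K : E3 → Fin 3 → ℝ) (x p : E3) :
    Matrix (Fin 2) (Fin 2) ℂ :=
  ((‖p‖ ^ 2 / (2 * m) + U x : ℝ) : ℂ) • (1 : Matrix (Fin 2) (Fin 2) ℂ) +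
    (hbar : ℂ) • dotPauli (crossProduct p.ofLp (K x) - B x)

/-! ### Weyl quantization on test functions -/

/-- `φ ∈ C_0^∞(ℝ³; ℂ²)`. -/
def IsTestFunction (φ : E3 → Spin) : Prop :=
  ContDiff ℝ ∞ φ ∧ HasCompactSupport φ

/-- `C_0^∞(ℝ³; ℂ²)` as a linear subspace of `L²(ℝ³; ℂ²)`. -/
def testSubmodule : Submodule ℂ L2Spin where
  carrier := {ψ | ∃ φ : E3 → Spin, IsTestFunction φ ∧ ψ =ᵐ[volume] φ}
  zero_mem' := ⟨0, ⟨contDiff_const, HasCompactSupport.zero⟩, Lp.coeFn_zero _ _ _⟩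
  add_mem' := by
    rintro a b ⟨f, ⟨hf, hf'⟩, ha⟩ ⟨g, ⟨hg, hg'⟩, hb⟩
    exact ⟨f + g, ⟨hf.add hg, hf'.add hg'⟩, (Lp.coeFn_add a b).trans (ha.add hb)⟩
  smul_mem' := by
    rintro c a ⟨f, ⟨hf, hf'⟩, ha⟩
    refine ⟨c • f, ⟨contDiff_const.smul hf, ?_⟩, (Lp.coeFn_smul c a).trans (ha.const_smul c)⟩
    exact hf'.smul_left (f := fun _ => c)

/-- The integrand `⟨χ(x), a((x+y)/2, p) φ(y)⟩ e^{i (x-y)·p/ħ}` of the Weyl quantization of the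
matrix-valued symbol `a`, applied to `φ` and paired with `χ`. -/
def weylIntegrand (hbar : ℝ) (a : E3 → E3 → Matrix (Fin 2) (Fin 2) ℂ) (χ φ : E3 → Spin)
    (p : E3) (z : E3 × E3) : ℂ :=
  inner ℂ (χ z.1) (WithLp.toLp 2 (a (midpoint ℝ z.1 z.2) p *ᵥ (φ z.2).ofLp) : Spin) *
    Complex.exp (Complex.I / (hbar : ℂ) * ((inner ℝ (z.1 - z.2) p : ℝ) : ℂ))

/-- `A` is the operator `Op(a)` in `L²(ℝ³; ℂ²)` with domain `C_0^∞(ℝ³; ℂ²)`, where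
`(Op(a) ψ)(x) = (2πħ)⁻³ ∫∫ a((x+y)/2, p) ψ(y) e^{i(x-y)·p/ħ} dy dp`.
As usual this oscillatory integral is read in the sense of distributions: it is tested against
`χ ∈ C_0^∞(ℝ³; ℂ²)`, and the integration over `p` is done last. Both integrals are then required to
converge absolutely. -/
structure IsWeylOperator (hbar : ℝ) (a : E3 → E3 → Matrix (Fin 2) (Fin 2) ℂ)
    (A : L2Spin →ₗ.[ℂ] L2Spin) : Prop where
  domain_eq : A.domain = testSubmodule
  integrable_inner : ∀ χ φ, IsTestFunction χ → IsTestFunction φ → ∀ p,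
    Integrable (weylIntegrand hbar a χ φ p) volume
  integrable_outer : ∀ χ φ, IsTestFunction χ → IsTestFunction φ →
    Integrable (fun p => ∫ z, weylIntegrand hbar a χ φ p z) volume
  pairing : ∀ χ φ, IsTestFunction χ → IsTestFunction φ →
    ∀ ψ : A.domain, (ψ : L2Spin) =ᵐ[volume] φ →
      ∫ x, inner ℂ (χ x) (A ψ x) =
        (((2 * Real.pi * hbar) ^ 3)⁻¹ : ℝ) * ∫ p, ∫ z, weylIntegrand hbar a χ φ p z

/-- A densely defined symmetric operator whose closure is self-adjoint. -/
def IsEssentiallySelfAdjoint (A : L2Spin →ₗ.[ℂ] L2Spin) : Prop :=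
  Dense (A.domain : Set L2Spin) ∧ A.IsFormalAdjoint A ∧ IsSelfAdjoint A.closure

end Rashba

end

/-! On test functions the quantization is a differential operator `-cΔ + V` with `c = ħ²/2m`, where
`V` collects `U`, `-ħ B·σ` and the symmetrized terms `-iħ (K_l ∂_j + ½ ∂_j K_l)` times constant
matrices. All coefficients of `V` are bounded, so `V` is a first order perturbation of the
Laplacian.

To find this form, pass to `r = (x+y)/2` and `s = x-y`. The inner Weyl integral becomes the Fourier
integral in `s` of a correlation function of `χ` and `φ`, weighted by the coefficient at `r`. This
function is smooth even for rough coefficients, because its `s`-derivatives fall on `χ` and `φ`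
only. Powers of `p` become `s`-derivatives (`mul_oscInt`), and the integral over `p` is Fourier
inversion at `s = 0` (`integral_oscInt`). The weak derivative of `K` appears when derivatives are
moved from `χ` to `φ` (`corr_dirDeriv_add`).

Symmetry follows from the Hermitian symbol by exchanging `x` and `y`. Self-adjointness of the
closure follows once the ranges of `A ± iμ` are dense for some `μ > 0`
(`LinearPMap.IsFormalAdjoint.isSelfAdjoint_closure`). For `V = 0` this is a division on the Fourier
side. In general `‖f‖` and `‖∂_j f‖` are at most `μ⁻¹` and `(cμ)^(-1/2)` times `‖(-cΔ ± iμ)f‖`, so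
for large `μ` the perturbation has relative bound 1/2 (`FirstOrderBounded.exists_small`) and density
survives (`dense_range_perturbed`). -/

namespace LinearPMap

/-! ### Dense ranges of `A ± iμ` imply essential self-adjointness. -/

variable {H : Type*} [NormedAddCommGroup H] [InnerProductSpace ℂ H]

/-- A symmetric operator `A` satisfies `‖(A + iμ) x‖² = ‖A x‖² + μ² ‖x‖²`. -/
theorem _root_.norm_add_I_smul_sq {a x : H} (h : (inner ℂ a x).im = 0) (μ : ℝ) :
    ‖a + (Complex.I * μ) • x‖ ^ 2 = ‖a‖ ^ 2 + μ ^ 2 * ‖x‖ ^ 2 := by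
  rw [@norm_add_sq ℂ, norm_smul, inner_smul_right]
  simp [mul_pow, h]

theorem IsFormalAdjoint.inner_self_im {A : H →ₗ.[ℂ] H} (hs : A.IsFormalAdjoint A) (x : A.domain) :
    (inner ℂ (A x) (x : H)).im = 0 := by
  rw [← Complex.conj_eq_iff_im, inner_conj_symm]
  exact (hs x x).symm

variable [CompleteSpace H]

theorem IsFormalAdjoint.isClosable {A : H →ₗ.[ℂ] H} (hd : Dense (A.domain : Set H))
    (hs : A.IsFormalAdjoint A) : A.IsClosable :=
  (adjoint_isClosed hd).isClosable.leIsClosable (hs.le_adjoint hd)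

theorem IsFormalAdjoint.closure_le_adjoint {A : H →ₗ.[ℂ] H} (hd : Dense (A.domain : Set H))
    (hs : A.IsFormalAdjoint A) : A.closure ≤ A† := by
  refine le_of_le_graph ?_
  rw [← (hs.isClosable hd).graph_closure_eq_closure_graph]
  exact Submodule.topologicalClosure_minimal _ (le_graph_of_le (hs.le_adjoint hd))
    (adjoint_isClosed hd)

/-- If the range of `A + iμ` is dense and that of `A - iμ` too, then the adjoint of the symmetric
operator `A` is contained in its closure. -/
theorem IsFormalAdjoint.adjoint_le_closure {A : H →ₗ.[ℂ] H} (hd : Dense (A.domain : Set H))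
    (hs : A.IsFormalAdjoint A) {μ : ℝ} (hμ : 0 < μ)
    (hp : DenseRange fun x : A.domain => A x + (Complex.I * μ) • (x : H))
    (hm : DenseRange fun x : A.domain => A x - (Complex.I * μ) • (x : H)) :
    A† ≤ A.closure := by
  have hcl := hs.isClosable hd
  refine le_of_le_graph ?_
  rintro ⟨x, y⟩ hxy
  obtain ⟨x, rfl, rfl⟩ := (A†.mem_graph_iff).1 hxy
  -- approximate `(A† + iμ) x` by `(A + iμ) (u n)`
  obtain ⟨u, hu⟩ := mem_closure_iff_seq_limit.1 (hp (A† x + (Complex.I * μ) • (x : H)))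
  obtain ⟨hur, hul⟩ := hu
  choose v hv using hur
  have hvl : Tendsto (fun n => A (v n) + (Complex.I * μ) • (v n : H)) atTop
      (𝓝 (A† x + (Complex.I * μ) • (x : H))) := by
    simpa only [hv] using hul
  -- Symmetry bounds `A + iμ` from below, so convergence of `(A + iμ)(v n)` forces `v n` to be
  -- Cauchy.
  have hbound : ∀ w : A.domain, μ * ‖(w : H)‖ ≤ ‖A w + (Complex.I * μ) • (w : H)‖ := by
    intro w
    have h := norm_add_I_smul_sq (hs.inner_self_im w) μ
    refine (pow_le_pow_iff_left₀ (by positivity) (norm_nonneg _) two_ne_zero).1 ?_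
    rw [h, mul_pow]
    exact le_add_of_nonneg_left (sq_nonneg _)
  have hcau : CauchySeq fun n => (v n : H) := by
    have hc := hvl.cauchySeq
    rw [Metric.cauchySeq_iff] at hc ⊢
    intro ε hε
    obtain ⟨N, hN⟩ := hc (μ * ε) (by positivity)
    refine ⟨N, fun m hm n hn => ?_⟩
    have h1 := hN m hm n hn
    have h2 := hbound (v m - v n)
    rw [dist_eq_norm] at h1 ⊢
    have h3 : A (v m) + (Complex.I * μ) • (v m : H) - (A (v n) + (Complex.I * μ) • (v n : H)) =
        A (v m - v n) + (Complex.I * μ) • ((v m - v n : A.domain) : H) := by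
      rw [A.map_sub, Submodule.coe_sub, smul_sub]; abel
    rw [h3] at h1
    have h4 := h2.trans_lt h1
    rw [Submodule.coe_sub] at h4
    exact lt_of_mul_lt_mul_left h4 hμ.le
  obtain ⟨z, hz⟩ := cauchySeq_tendsto_of_complete hcau
  have hAz : Tendsto (fun n => A (v n)) atTop
      (𝓝 (A† x + (Complex.I * μ) • (x : H) - (Complex.I * μ) • z)) := by
    have := hvl.sub (hz.const_smul (Complex.I * μ))
    simpa using this
  have hmem : (z, A† x + (Complex.I * μ) • (x : H) - (Complex.I * μ) • z) ∈ A.closure.graph := by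
    rw [← hcl.graph_closure_eq_closure_graph]
    refine mem_closure_of_tendsto (hz.prodMk_nhds hAz) (Eventually.of_forall fun n => ?_)
    exact A.mem_graph (v n)
  obtain ⟨w, hw1, hw2⟩ := (A†.mem_graph_iff).1 (le_graph_of_le (hs.closure_le_adjoint hd) hmem)
  have hw1 : (w : H) = z := hw1
  have hw2 : A† w = A† x + (Complex.I * μ) • (x : H) - (Complex.I * μ) • z := hw2
  -- By construction `A†(x - z) = -iμ (x - z)`, so `x - z` is orthogonal to the range of `A - iμ`,
  -- which is dense.
  have hzero : (x : H) - z = 0 := by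
    refine hm.eq_zero_of_inner_left ℂ (fun y => ?_)
    have h1 := adjoint_isFormalAdjoint hd x y
    have h2 := adjoint_isFormalAdjoint hd w y
    rw [hw1, hw2] at h2
    have h3 : inner ℂ ((Complex.I * μ) • ((x : H) - z)) (y : H) =
        -(inner ℂ ((x : H) - z) ((Complex.I * μ) • (y : H))) := by
      rw [inner_smul_left, inner_smul_right]; simp
    rw [inner_sub_right, inner_sub_left (x : H) z (A y), ← h1, ← h2, ← inner_sub_left,
      ← neg_eq_iff_eq_neg.2 h3, sub_neg_eq_add, ← inner_add_left]
    convert inner_zero_left (𝕜 := ℂ) (y : H) using 2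
    rw [smul_sub]; abel
  have hzx : z = x := (sub_eq_zero.1 hzero).symm
  subst hzx
  simpa using hmem

/-- Density of the two ranges gives `A.closure = A†`. The closure inherits symmetry, hence lies
below its own adjoint; conversely that adjoint is formally adjoint to `A`, hence lies below `A†`. -/
theorem IsFormalAdjoint.isSelfAdjoint_closure {A : H →ₗ.[ℂ] H} (hd : Dense (A.domain : Set H))
    (hs : A.IsFormalAdjoint A) {μ : ℝ} (hμ : 0 < μ)
    (hp : DenseRange fun x : A.domain => A x + (Complex.I * μ) • (x : H))
    (hm : DenseRange fun x : A.domain => A x - (Complex.I * μ) • (x : H)) :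
    IsSelfAdjoint A.closure := by
  have heq : A.closure = A† :=
    le_antisymm (hs.closure_le_adjoint hd) (hs.adjoint_le_closure hd hμ hp hm)
  have hdc : Dense (A.closure.domain : Set H) := hd.mono A.le_closure.1
  have h1 : A.closure†.IsFormalAdjoint A := by
    intro x y
    have hy : (y : H) ∈ A.closure.domain := A.le_closure.1 y.2
    have := adjoint_isFormalAdjoint hdc x ⟨y, hy⟩
    rw [← A.le_closure.2 (x := y) (y := ⟨y, hy⟩) rfl] at this
    exact this
  have h2 : A.closure.IsFormalAdjoint A.closure := by
    intro x y
    have hx : ((x : H)) ∈ A†.domain := heq ▸ x.2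
    have hAx : A† ⟨x, hx⟩ = A.closure x :=
      ((hs.closure_le_adjoint hd).2 (x := x) (y := ⟨x, hx⟩) rfl).symm
    -- For fixed `x` the symmetry identity is a closed condition on pairs of the graph, so it passes
    -- from the graph of `A` to its closure.
    have hy : ((y : H), A.closure y) ∈ A.graph.topologicalClosure := by
      rw [(hs.isClosable hd).graph_closure_eq_closure_graph]; exact A.closure.mem_graph y
    have hcl : _root_.IsClosed {q : H × H | inner ℂ (A.closure x) q.1 = inner ℂ (x : H) q.2} :=
      isClosed_eq (by fun_prop) (by fun_prop)
    have hsub : (A.graph : Set (H × H)) ⊆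
        {q : H × H | inner ℂ (A.closure x) q.1 = inner ℂ (x : H) q.2} := by
      rintro ⟨a, b⟩ hab
      obtain ⟨a, rfl, rfl⟩ := (A.mem_graph_iff).1 hab
      have := adjoint_isFormalAdjoint hd ⟨x, hx⟩ a
      rw [hAx] at this
      exact this
    exact closure_minimal hsub hcl hy
  rw [isSelfAdjoint_def]
  refine le_antisymm ?_ (h2.le_adjoint hdc)
  conv_rhs => rw [heq]
  exact h1.symm.le_adjoint hd

end LinearPMap

noncomputable section

namespace Rashba

open SchwartzMap LineDeriv Laplacian FourierTransform


/-! ### A priori estimates for `-cΔ + iμ` on Schwartz functions. -/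

/-- The `j`-th standard basis vector of `ℝ³`. -/
abbrev stdVec (j : Fin 3) : E3 := EuclideanSpace.single j (1 : ℝ)

/-- The inner product of `ℂ²` as a real bilinear map. -/
def innerReal : Spin →L[ℝ] Spin →L[ℝ] ℂ :=
  LinearMap.mkContinuous₂
    (LinearMap.mk₂ ℝ (fun x y : Spin => inner ℂ x y) inner_add_left
      (fun c x y => inner_smul_left_eq_smul x y c) inner_add_right
      (fun c x y => inner_smul_right_eq_smul x y c)) 1
    (fun x y => by simpa using norm_inner_le_norm x y)

@[simp] theorem innerReal_apply (x y : Spin) : innerReal x y = inner ℂ x y := rfl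

/-- The embedding of the Schwartz space into `L²(ℝ³; ℂ²)`. -/
def emb : 𝓢(E3, Spin) →L[ℂ] L2Spin := toLpCLM ℂ Spin 2 volume

theorem coeFn_emb (f : 𝓢(E3, Spin)) : emb f =ᵐ[volume] f := f.coeFn_toLp 2

theorem emb_injective : Function.Injective emb := injective_toLp 2 volume

theorem inner_emb_emb (f g : 𝓢(E3, Spin)) : inner ℂ (emb f) (emb g) = ∫ x, inner ℂ (f x) (g x) :=
  inner_toL2_toL2_eq f g

theorem laplacian_eq_sum_stdVec (f : 𝓢(E3, Spin)) :
    Δ f = ∑ j, ∂_{stdVec j} (∂_{stdVec j} f) := by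
  simpa using laplacian_eq_sum (EuclideanSpace.basisFun (Fin 3) ℝ) f

theorem inner_lineDeriv_right (f g : 𝓢(E3, Spin)) (v : E3) :
    inner ℂ (emb f) (emb (∂_{v} g)) = -inner ℂ (emb (∂_{v} f)) (emb g) := by
  simp only [inner_emb_emb]
  exact integral_bilinear_lineDerivOp_right_eq_neg_left (μ := volume) f g innerReal v

/-- One integration by parts in each coordinate. That the value is real gives the free resolvent
identity; its size controls the gradient. -/
theorem inner_laplacian_self (f : 𝓢(E3, Spin)) :
    inner ℂ (emb (Δ f)) (emb f) = ((-∑ j, ‖emb (∂_{stdVec j} f)‖ ^ 2 : ℝ) : ℂ) := by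
  rw [laplacian_eq_sum_stdVec, map_sum, sum_inner]
  simp only [← neg_eq_iff_eq_neg.2 (inner_lineDeriv_right _ f _), inner_self_eq_norm_sq_to_K]
  simp

theorem norm_lineDeriv_sq_le (f : 𝓢(E3, Spin)) (j : Fin 3) :
    ‖emb (∂_{stdVec j} f)‖ ^ 2 ≤ ‖emb (Δ f)‖ * ‖emb f‖ := by
  calc ‖emb (∂_{stdVec j} f)‖ ^ 2 ≤ ∑ j, ‖emb (∂_{stdVec j} f)‖ ^ 2 :=
        Finset.single_le_sum (f := fun j => ‖emb (∂_{stdVec j} f)‖ ^ 2)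
          (fun _ _ => sq_nonneg _) (Finset.mem_univ j)
    _ ≤ ‖inner ℂ (emb (Δ f)) (emb f)‖ := by
        rw [inner_laplacian_self, Complex.norm_real, norm_neg]; exact Real.le_norm_self _
    _ ≤ _ := norm_inner_le_norm _ _

/-- The free resolvent estimate. -/
theorem norm_free_sq (c μ : ℝ) (f : 𝓢(E3, Spin)) :
    ‖emb ((-c : ℂ) • Δ f + (Complex.I * μ) • f)‖ ^ 2 =
      c ^ 2 * ‖emb (Δ f)‖ ^ 2 + μ ^ 2 * ‖emb f‖ ^ 2 := by
  have h : (inner ℂ ((-c : ℂ) • emb (Δ f)) (emb f)).im = 0 := by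
    rw [inner_smul_left, inner_laplacian_self]
    simp [-Complex.ofReal_neg, -Complex.ofReal_pow, -Complex.ofReal_sum]
  rw [map_add, map_smul, map_smul, norm_add_I_smul_sq h, norm_smul, mul_pow]
  simp

theorem norm_laplacian_le {c : ℝ} (hc : 0 < c) (μ : ℝ) (f : 𝓢(E3, Spin)) :
    c * ‖emb (Δ f)‖ ≤ ‖emb ((-c : ℂ) • Δ f + (Complex.I * μ) • f)‖ := by
  refine (pow_le_pow_iff_left₀ (by positivity) (norm_nonneg _) two_ne_zero).1 ?_
  rw [norm_free_sq, mul_pow]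
  exact le_add_of_nonneg_right (by positivity)

theorem norm_le_norm_free (c μ : ℝ) (f : 𝓢(E3, Spin)) :
    |μ| * ‖emb f‖ ≤ ‖emb ((-c : ℂ) • Δ f + (Complex.I * μ) • f)‖ := by
  refine (pow_le_pow_iff_left₀ (by positivity) (norm_nonneg _) two_ne_zero).1 ?_
  rw [norm_free_sq, mul_pow, sq_abs]
  exact le_add_of_nonneg_left (by positivity)

/-- Multiply the bounds on `c‖Δf‖` and `|μ|‖f‖` and interpolate the gradient between them. The gain
`|μ|^(1/2)` is what makes first order terms small. -/
theorem norm_lineDeriv_le {c : ℝ} (hc : 0 < c) {μ : ℝ} (hμ : μ ≠ 0) (f : 𝓢(E3, Spin)) (j : Fin 3) :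
    √(c * |μ|) * ‖emb (∂_{stdVec j} f)‖ ≤ ‖emb ((-c : ℂ) • Δ f + (Complex.I * μ) • f)‖ := by
  have hμ' : 0 < |μ| := abs_pos.2 hμ
  refine (pow_le_pow_iff_left₀ (by positivity) (norm_nonneg _) two_ne_zero).1 ?_
  rw [mul_pow, Real.sq_sqrt (by positivity)]
  calc c * |μ| * ‖emb (∂_{stdVec j} f)‖ ^ 2 ≤ c * |μ| * (‖emb (Δ f)‖ * ‖emb f‖) := by
        gcongr; exact norm_lineDeriv_sq_le f j
    _ = (c * ‖emb (Δ f)‖) * (|μ| * ‖emb f‖) := by ring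
    _ ≤ _ := by
        rw [sq]
        gcongr
        · exact norm_laplacian_le hc μ f
        · exact norm_le_norm_free c μ f

/-! ### Density of the range of the free operator -/

/-- The embeddings of test functions. -/
theorem mem_testSubmodule_iff (ψ : L2Spin) :
    ψ ∈ testSubmodule ↔ ∃ f : 𝓢(E3, Spin), HasCompactSupport f ∧ emb f = ψ := by
  constructor
  · rintro ⟨φ, ⟨h1, h2⟩, h⟩
    refine ⟨h2.toSchwartzMap h1, h2, Lp.ext ((coeFn_emb _).trans h.symm)⟩
  · rintro ⟨f, hf, rfl⟩
    exact ⟨f, ⟨f.smooth ⊤, hf⟩, coeFn_emb f⟩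

theorem dense_testSubmodule : Dense (testSubmodule : Set L2Spin) := by
  refine (Lp.dense_hasCompactSupport_contDiff (F := Spin) (μ := (volume : Measure E3)) (p := 2)
    (by simp)).mono ?_
  rintro f ⟨g, h1, h2, h3⟩
  exact ⟨g, ⟨h3, h2⟩, h1⟩

theorem fourier_laplacian_apply (f : 𝓢(E3, Spin)) (ξ : E3) :
    𝓕 (Δ f) ξ = (-(2 * Real.pi) ^ 2 * ‖ξ‖ ^ 2 : ℝ) • 𝓕 f ξ := by
  rw [laplacian_eq_fourierMultiplierCLM, fourierMultiplierCLM_apply, FourierTransform.fourier_smul,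
    fourier_fourierInv_eq, smul_apply]
  have h : (fun ξ : E3 => ‖ξ‖ ^ 2).HasTemperateGrowth := Function.hasTemperateGrowth_norm_sq E3
  have := smulLeftCLM_apply_apply h (𝓕 f) ξ
  erw [this]
  rw [smul_smul]

/-- The Fourier transform turns the operator into multiplication by `q`, which has imaginary part `μ
≠ 0` and so never vanishes. Any test function `k` can be divided by `q`, hence the inverse
transforms of test functions, a dense set, lie in the range. -/
theorem dense_range_free_schwartz (c : ℝ) {μ : ℝ} (hμ : μ ≠ 0) :
    DenseRange fun f : 𝓢(E3, Spin) => emb ((-c : ℂ) • Δ f + (Complex.I * μ) • f) := by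
  let e := Lp.fourierTransformₗᵢ E3 Spin
  have h1 : Dense (e.symm '' (testSubmodule : Set L2Spin)) :=
    e.symm.surjective.denseRange.dense_image e.symm.continuous dense_testSubmodule
  refine h1.mono ?_
  rintro _ ⟨ψ, hψ, rfl⟩
  obtain ⟨k, hk, rfl⟩ := (mem_testSubmodule_iff ψ).1 hψ
  let q : E3 → ℂ := fun ξ => ((c * (2 * Real.pi) ^ 2 * ‖ξ‖ ^ 2 : ℝ) : ℂ) + Complex.I * μ
  have hq : ∀ ξ, q ξ ≠ 0 := fun ξ h => hμ (by simpa [q, -Complex.ofReal_mul, -Complex.ofReal_pow] using congrArg Complex.im h)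
  have hq' : ContDiff ℝ ∞ q := by
    refine (Complex.ofRealCLM.contDiff.comp (contDiff_const.mul (contDiff_norm_sq ℝ))).add
      contDiff_const
  have hk' : HasCompactSupport fun ξ => (q ξ)⁻¹ • k ξ := hk.smul_left (f := fun ξ => (q ξ)⁻¹)
  let h : 𝓢(E3, Spin) := hk'.toSchwartzMap ((hq'.inv hq).smul (k.smooth ⊤))
  refine ⟨𝓕⁻ h, ?_⟩
  have h2 : (-c : ℂ) • Δ (𝓕⁻ h) + (Complex.I * μ) • 𝓕⁻ h = 𝓕⁻ k := by
    have : 𝓕 ((-c : ℂ) • Δ (𝓕⁻ h) + (Complex.I * μ) • 𝓕⁻ h) = k := by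
      ext1 ξ
      rw [FourierTransform.fourier_add, FourierTransform.fourier_smul,
        FourierTransform.fourier_smul, fourier_fourierInv_eq]
      have h3 : q ξ • h ξ = k ξ := smul_inv_smul₀ (hq ξ) (k ξ)
      have h4 := fourier_laplacian_apply (𝓕⁻ h) ξ
      rw [fourier_fourierInv_eq] at h4
      rw [add_apply, smul_apply, smul_apply, h4, ← h3, ← Complex.coe_smul, smul_smul, ← add_smul]
      congr 1
      simp only [q]
      push_cast
      ring
    rw [← this, fourierInv_fourier_eq]
  simp only [h2]
  exact (toLp_fourierInv_eq k).symm

theorem lineDeriv_smulLeft (ρ : 𝓢(E3, ℝ)) (f : 𝓢(E3, Spin)) (v : E3) :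
    ∂_{v} (smulLeftCLM Spin ρ f) =
      smulLeftCLM Spin (∂_{v} ρ : 𝓢(E3, ℝ)) f + smulLeftCLM Spin ρ (∂_{v} f) := by
  ext1 x
  rw [add_apply, smulLeftCLM_apply_apply (by fun_prop), smulLeftCLM_apply_apply (by fun_prop),
    lineDerivOp_apply_eq_fderiv, lineDerivOp_apply_eq_fderiv, lineDerivOp_apply_eq_fderiv,
    smulLeftCLM_apply (by fun_prop), fderiv_fun_smul ρ.differentiableAt f.differentiableAt]
  simp [add_comm]

/-- The rescaled function `x ↦ ρ (a x)`. -/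
def rescale (a : ℝˣ) : 𝓢(E3, ℝ) →L[ℝ] 𝓢(E3, ℝ) :=
  compCLMOfContinuousLinearEquiv ℝ (ContinuousLinearEquiv.smulLeft (M₁ := E3) (R₁ := ℝ) a)

theorem rescale_apply (a : ℝˣ) (ρ : 𝓢(E3, ℝ)) (x : E3) : rescale a ρ x = ρ ((a : ℝ) • x) := rfl

theorem lineDeriv_rescale (a : ℝˣ) (ρ : 𝓢(E3, ℝ)) (v : E3) :
    (∂_{v} (rescale a ρ) : 𝓢(E3, ℝ)) = (a : ℝ) • rescale a (∂_{v} ρ) := by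
  rw [rescale, lineDerivOp_compCLMOfContinuousLinearEquiv]
  change compCLMOfContinuousLinearEquiv ℝ _ (∂_{(a : ℝ) • v} ρ) = _
  rw [lineDerivOp_left_smul, map_smul]

theorem laplacian_cutoff_apply (a : ℝˣ) (ρ : 𝓢(E3, ℝ)) (f : 𝓢(E3, Spin)) (x : E3) :
    Δ (smulLeftCLM Spin (rescale a ρ) f) x = ∑ j,
      (((a : ℝ) ^ 2 * (∂_{stdVec j} (∂_{stdVec j} ρ) : 𝓢(E3, ℝ)) ((a : ℝ) • x)) • f x +
        (2 * ((a : ℝ) * (∂_{stdVec j} ρ : 𝓢(E3, ℝ)) ((a : ℝ) • x))) • (∂_{stdVec j} f) x +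
        ρ ((a : ℝ) • x) • (∂_{stdVec j} (∂_{stdVec j} f)) x) := by
  rw [laplacian_eq_sum_stdVec, sum_apply]
  refine Finset.sum_congr rfl fun j _ => ?_
  rw [lineDeriv_smulLeft, lineDerivOp_add, lineDeriv_smulLeft, lineDeriv_smulLeft]
  simp only [add_apply, lineDeriv_rescale, lineDerivOp_smul]
  simp (discharger := fun_prop) only [smulLeftCLM_apply_apply, smul_apply, rescale_apply]
  module

theorem tendsto_inner_of_dominated (η : L2Spin) {g : ℕ → 𝓢(E3, Spin)} {g₀ : 𝓢(E3, Spin)}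
    {F : E3 → ℝ} (hF : MemLp F 2) (hb : ∀ n x, ‖g n x‖ ≤ F x)
    (hg : ∀ x, Tendsto (fun n => g n x) atTop (𝓝 (g₀ x))) :
    Tendsto (fun n => inner ℂ η (emb (g n))) atTop (𝓝 (inner ℂ η (emb g₀))) := by
  have key : ∀ k : 𝓢(E3, Spin), inner ℂ η (emb k) = ∫ x, inner ℂ (η x) (k x) := fun k => by
    rw [L2.inner_def]
    refine integral_congr_ae ?_
    filter_upwards [coeFn_emb k] with x hx
    rw [hx]
  simp only [key]
  refine tendsto_integral_of_dominated_convergence (fun x => ‖η x‖ * F x) (fun n => ?_) ?_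
    (fun n => ?_) ?_
  · exact (Lp.aestronglyMeasurable η).inner (g n).continuous.aestronglyMeasurable
  · exact (Lp.memLp η).norm.integrable_mul hF
  · refine Eventually.of_forall fun x => (norm_inner_le_norm _ _).trans ?_
    gcongr
    exact hb n x
  · exact Eventually.of_forall fun x => tendsto_const_nhds.inner (hg x)

theorem exists_forall_abs_le (ρ : 𝓢(E3, ℝ)) : ∃ M, ∀ x, |ρ x| ≤ M :=
  ⟨_, fun x => norm_le_seminorm ℝ ρ x⟩

/-- Compactly supported Schwartz functions. -/
def testSchwartz : Submodule ℂ 𝓢(E3, Spin) where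
  carrier := {f | HasCompactSupport f}
  zero_mem' := HasCompactSupport.zero
  add_mem' hf hg := hf.add hg
  smul_mem' c _ hf := hf.smul_left (f := fun _ => c)

/-- The approximation of a Schwartz function by test functions, in the weak sense that suffices for
density arguments. -/
theorem exists_test_tendsto (f : 𝓢(E3, Spin)) : ∃ g : ℕ → 𝓢(E3, Spin),
    (∀ n, g n ∈ testSchwartz) ∧ ∀ η : L2Spin,
      Tendsto (fun n => inner ℂ η (emb (g n))) atTop (𝓝 (inner ℂ η (emb f))) ∧
      Tendsto (fun n => inner ℂ η (emb (Δ (g n)))) atTop (𝓝 (inner ℂ η (emb (Δ f)))) := by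
  let β : ContDiffBump (0 : E3) := ⟨1, 2, one_pos, one_lt_two⟩
  let ρ : 𝓢(E3, ℝ) := β.hasCompactSupport.toSchwartzMap β.contDiff
  have hρ0 : ρ 0 = 1 := β.one_of_mem_closedBall (by simp [β])
  -- The cutoffs are `ρ(x/(n+1))`: they tend pointwise to `ρ 0 = 1`, and each derivative falling on
  -- them brings a factor `a n ≤ 1` that tends to zero.
  let a : ℕ → ℝˣ := fun n => Units.mk0 (1 / ((n : ℝ) + 1)) (by positivity)
  have ha : Tendsto (fun n => (a n : ℝ)) atTop (𝓝 0) := tendsto_one_div_add_atTop_nhds_zero_nat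
  have ha0 : ∀ n, 0 ≤ (a n : ℝ) := fun n => by simp only [a, Units.val_mk0]; positivity
  have ha1 : ∀ n, (a n : ℝ) ≤ 1 := fun n => by
    simp only [a, Units.val_mk0]
    rw [div_le_one (by positivity)]
    linarith [n.cast_nonneg (α := ℝ)]
  have hax : ∀ x : E3, Tendsto (fun n => (a n : ℝ) • x) atTop (𝓝 0) := fun x => by
    simpa using ha.smul_const x
  have hcont : ∀ (k : 𝓢(E3, ℝ)) (x : E3),
      Tendsto (fun n => k ((a n : ℝ) • x)) atTop (𝓝 (k 0)) := fun k x =>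
    (k.continuous.tendsto 0).comp (hax x)
  obtain ⟨M0, hM0⟩ := exists_forall_abs_le ρ
  choose M1 hM1 using fun j => exists_forall_abs_le (∂_{stdVec j} ρ)
  choose M2 hM2 using fun j => exists_forall_abs_le (∂_{stdVec j} (∂_{stdVec j} ρ))
  refine ⟨fun n => smulLeftCLM Spin (rescale (a n) ρ) f, fun n => ?_, fun η => ⟨?_, ?_⟩⟩
  · have h1 : HasCompactSupport (rescale (a n) ρ) :=
      β.hasCompactSupport.comp_homeomorph (Homeomorph.smul (a n))
    change HasCompactSupport (smulLeftCLM Spin (rescale (a n) ρ) f)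
    rw [smulLeftCLM_apply (by fun_prop)]
    exact h1.smul_right
  · refine tendsto_inner_of_dominated η (F := fun x => M0 * ‖f x‖)
      ((f.memLp 2).norm.const_mul M0) (fun n x => ?_) (fun x => ?_)
    · rw [smulLeftCLM_apply_apply (by fun_prop), norm_smul, rescale_apply]
      gcongr
      exact hM0 _
    · simp (discharger := fun_prop) only [smulLeftCLM_apply_apply, rescale_apply]
      simpa [hρ0] using (hcont ρ x).smul_const (f x)
  · refine tendsto_inner_of_dominated η (F := fun x => ∑ j, (M2 j * ‖f x‖ +
      2 * M1 j * ‖(∂_{stdVec j} f) x‖ + M0 * ‖(∂_{stdVec j} (∂_{stdVec j} f)) x‖))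
      (memLp_finsetSum _ fun j _ => (((f.memLp 2).norm.const_mul _).add
        (((∂_{stdVec j} f).memLp 2).norm.const_mul _)).add
        (((∂_{stdVec j} (∂_{stdVec j} f)).memLp 2).norm.const_mul _)) (fun n x => ?_) (fun x => ?_)
    · rw [laplacian_cutoff_apply]
      refine norm_sum_le_of_le _ fun j _ => norm_add₃_le.trans ?_
      simp only [norm_smul, Real.norm_eq_abs, abs_mul, abs_pow, abs_two, abs_of_nonneg (ha0 n)]
      have h1 := hM2 j ((a n : ℝ) • x)
      have h2 := hM1 j ((a n : ℝ) • x)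
      have h3 := hM0 ((a n : ℝ) • x)
      have h4 : (a n : ℝ) ^ 2 ≤ 1 := pow_le_one₀ (ha0 n) (ha1 n)
      gcongr
      · exact (mul_le_of_le_one_left (abs_nonneg _) h4).trans h1
      · exact (mul_le_of_le_one_left (abs_nonneg _) (ha1 n)).trans h2
    · simp only [laplacian_cutoff_apply]
      rw [laplacian_eq_sum_stdVec, sum_apply]
      refine tendsto_finsetSum _ fun j _ => ?_
      have h1 := (((ha.pow 2).mul (hcont (∂_{stdVec j} (∂_{stdVec j} ρ)) x)).smul_const (f x))
      have h2 := ((ha.mul (hcont (∂_{stdVec j} ρ) x)).const_mul 2).smul_const ((∂_{stdVec j} f) x)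
      have h3 := (hcont ρ x).smul_const ((∂_{stdVec j} (∂_{stdVec j} f)) x)
      simpa [hρ0] using (h1.add h2).add h3

/-- A vector orthogonal to the images of test functions is orthogonal to the images of all Schwartz
functions, by weak approximation; hence it is zero. -/
theorem dense_range_free_test (c : ℝ) {μ : ℝ} (hμ : μ ≠ 0) :
    DenseRange fun f : testSchwartz =>
      emb ((-c : ℂ) • Δ (f : 𝓢(E3, Spin)) + (Complex.I * μ) • (f : 𝓢(E3, Spin))) := by
  let L : 𝓢(E3, Spin) →L[ℂ] L2Spin := emb ∘L
    ((-c : ℂ) • laplacianCLM ℂ E3 𝓢(E3, Spin) + (Complex.I * μ) • ContinuousLinearMap.id ℂ _)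
  have hL : ∀ f, L f = emb ((-c : ℂ) • Δ f + (Complex.I * μ) • f) := fun f => by simp [L]
  have hrange : Set.range (fun f : testSchwartz =>
      emb ((-c : ℂ) • Δ (f : 𝓢(E3, Spin)) + (Complex.I * μ) • (f : 𝓢(E3, Spin)))) =
      (testSchwartz.map (L : 𝓢(E3, Spin) →ₗ[ℂ] L2Spin) : Set L2Spin) := by
    ext u; simp [hL]
  rw [DenseRange, hrange, Submodule.dense_iff_topologicalClosure_eq_top,
    Submodule.topologicalClosure_eq_top_iff, Submodule.eq_bot_iff]
  intro η hη
  have hη' : ∀ f ∈ testSchwartz, inner ℂ η (L f) = 0 := fun f hf =>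
    (Submodule.mem_orthogonal' _ _).1 hη _ (Submodule.mem_map_of_mem hf)
  refine (dense_range_free_schwartz c hμ).eq_zero_of_inner_left ℂ fun f => ?_
  obtain ⟨g, hg, hlim⟩ := exists_test_tendsto f
  obtain ⟨h1, h2⟩ := hlim η
  have h3 := (h2.const_mul (-c : ℂ)).add (h1.const_mul (Complex.I * μ))
  have h4 : ∀ k : 𝓢(E3, Spin), inner ℂ η (emb ((-c : ℂ) • Δ k + (Complex.I * μ) • k)) =
      -c * inner ℂ η (emb (Δ k)) + Complex.I * μ * inner ℂ η (emb k) := fun k => by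
    rw [map_add, map_smul, map_smul, inner_add_right, inner_smul_right, inner_smul_right]
  rw [h4]
  refine tendsto_nhds_unique h3 (tendsto_const_nhds.congr fun n => ?_)
  rw [← h4, ← hL, hη' _ (hg n)]

/-! ### The correlation of two test functions -/

/-- The integrand of the correlation function of `χ` and `φ`, without weight. -/
def corrKernel (χ φ : E3 → Spin) (s r : E3) : ℂ :=
  inner ℂ (χ (r + (1 / 2 : ℝ) • s)) (φ (r - (1 / 2 : ℝ) • s))

/-- The correlation function of `χ` and `φ` with weight `b`. -/
def corr (b : E3 → ℝ) (χ φ : E3 → Spin) (s : E3) : ℂ :=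
  ∫ r, b r • corrKernel χ φ s r

theorem IsTestFunction.exists_radius {χ : E3 → Spin} (h : IsTestFunction χ) :
    ∃ R, ∀ x, R < ‖x‖ → χ x = 0 := by
  obtain ⟨R, hR⟩ := h.2.isCompact.isBounded.exists_norm_le
  refine ⟨R, fun x hx => ?_⟩
  by_contra h0
  exact (hR x (subset_tsupport _ h0)).not_gt hx

theorem IsTestFunction.exists_bound {χ : E3 → Spin} (h : IsTestFunction χ) :
    ∃ C, 0 ≤ C ∧ ∀ x, ‖χ x‖ ≤ C := by
  obtain ⟨C, hC⟩ := h.2.exists_bound_of_continuous h.1.continuous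
  exact ⟨C, (norm_nonneg _).trans (hC 0), hC⟩

/-- The support of the kernel is contained in a product of two balls. -/
theorem exists_corrKernel_support {χ φ : E3 → Spin} (hχ : IsTestFunction χ)
    (hφ : IsTestFunction φ) : ∃ R, ∀ s r, corrKernel χ φ s r ≠ 0 → ‖r‖ ≤ R ∧ ‖s‖ ≤ R := by
  obtain ⟨R₁, h₁⟩ := hχ.exists_radius
  obtain ⟨R₂, h₂⟩ := hφ.exists_radius
  refine ⟨|R₁| + |R₂|, fun s r h => ?_⟩
  have hx : ‖r + (1 / 2 : ℝ) • s‖ ≤ |R₁| := by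
    refine le_trans (not_lt.1 fun hlt => h ?_) (le_abs_self _)
    rw [corrKernel, h₁ _ hlt, inner_zero_left]
  have hy : ‖r - (1 / 2 : ℝ) • s‖ ≤ |R₂| := by
    refine le_trans (not_lt.1 fun hlt => h ?_) (le_abs_self _)
    rw [corrKernel, h₂ _ hlt, inner_zero_right]
  have hr : r = (1 / 2 : ℝ) • ((r + (1 / 2 : ℝ) • s) + (r - (1 / 2 : ℝ) • s)) := by module
  have hs : s = (r + (1 / 2 : ℝ) • s) - (r - (1 / 2 : ℝ) • s) := by module
  constructor
  · rw [hr, norm_smul]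
    have := norm_add_le (r + (1 / 2 : ℝ) • s) (r - (1 / 2 : ℝ) • s)
    rw [Real.norm_of_nonneg (by norm_num)]
    linarith [norm_nonneg ((r + (1 / 2 : ℝ) • s) + (r - (1 / 2 : ℝ) • s))]
  · rw [hs]
    exact (norm_sub_le _ _).trans (add_le_add hx hy)

theorem contDiff_corrKernel {χ φ : E3 → Spin} (hχ : IsTestFunction χ) (hφ : IsTestFunction φ) :
    ContDiff ℝ ∞ fun q : E3 × E3 => corrKernel χ φ q.1 q.2 := by
  refine ContDiff.inner ℂ (hχ.1.comp ?_) (hφ.1.comp ?_)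
  · exact contDiff_snd.add (contDiff_fst.const_smul (1 / 2 : ℝ))
  · exact contDiff_snd.sub (contDiff_fst.const_smul (1 / 2 : ℝ))

theorem continuous_corrKernel {χ φ : E3 → Spin} (hχ : IsTestFunction χ) (hφ : IsTestFunction φ) :
    Continuous fun q : E3 × E3 => corrKernel χ φ q.1 q.2 :=
  (contDiff_corrKernel hχ hφ).continuous

theorem exists_corrKernel_bound {χ φ : E3 → Spin} (hχ : IsTestFunction χ) (hφ : IsTestFunction φ) :
    ∃ C, ∀ s r, ‖corrKernel χ φ s r‖ ≤ C := by
  obtain ⟨C₁, h₀, h₁⟩ := hχ.exists_bound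
  obtain ⟨C₂, -, h₂⟩ := hφ.exists_bound
  exact ⟨C₁ * C₂, fun s r => (norm_inner_le_norm _ _).trans
    (mul_le_mul (h₁ _) (h₂ _) (norm_nonneg _) h₀)⟩

theorem corr_eq_zero {χ φ : E3 → Spin} {R : ℝ}
    (hR : ∀ s r, corrKernel χ φ s r ≠ 0 → ‖r‖ ≤ R ∧ ‖s‖ ≤ R) (b : E3 → ℝ) {s : E3} (hs : R < ‖s‖) :
    corr b χ φ s = 0 := by
  have : ∀ r, corrKernel χ φ s r = 0 := fun r => by
    by_contra h
    exact (hR s r h).2.not_gt hs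
  simp [corr, this]

theorem hasCompactSupport_corr (b : E3 → ℝ) {χ φ : E3 → Spin} (hχ : IsTestFunction χ)
    (hφ : IsTestFunction φ) : HasCompactSupport (corr b χ φ) := by
  obtain ⟨R, hR⟩ := exists_corrKernel_support hχ hφ
  refine HasCompactSupport.intro (isCompact_closedBall (0 : E3) R) fun s hs => ?_
  exact corr_eq_zero hR b (by simpa using hs)

/-- The weight does not involve `s`, so only the smooth kernel is differentiated. The integral is
read as a convolution with `b`, evaluated at the origin, whose second factor depends on the
parameter `s`; this explains the reflected argument `-y`. -/
theorem contDiff_corr {b : E3 → ℝ} (hb : LocallyIntegrable b) {χ φ : E3 → Spin}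
    (hχ : IsTestFunction χ) (hφ : IsTestFunction φ) : ContDiff ℝ ∞ (corr b χ φ) := by
  obtain ⟨R, hR⟩ := exists_corrKernel_support hχ hφ
  have key := contDiffOn_convolution_right_with_param_comp (μ := (volume : Measure E3)) (n := ⊤)
    (ContinuousLinearMap.lsmul ℝ ℝ : ℝ →L[ℝ] ℂ →L[ℝ] ℂ) (s := Set.univ) (v := fun _ : E3 => (0 : E3))
    contDiffOn_const (f := b) (g := fun s y => corrKernel χ φ s (-y))
    (k := Metric.closedBall 0 R) isOpen_univ (isCompact_closedBall _ _) ?_ hb ?_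
  · rw [contDiffOn_univ] at key
    convert key using 2 with s
    simp [corr, MeasureTheory.convolution]
  · intro s y _ hy
    by_contra h
    exact hy (by simpa using (hR _ _ h).1)
  · refine ContDiff.contDiffOn ?_
    exact (contDiff_corrKernel hχ hφ).comp (contDiff_fst.prodMk contDiff_snd.neg)

/-- The directional derivative of a test function. -/
def dirDeriv (v : E3) (χ : E3 → Spin) (x : E3) : Spin := fderiv ℝ χ x v

theorem IsTestFunction.dirDeriv {χ : E3 → Spin} (h : IsTestFunction χ) (v : E3) :
    IsTestFunction (dirDeriv v χ) :=
  ⟨(h.1.fderiv_right (m := ∞) (by simp)).clm_apply contDiff_const,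
    h.2.fderiv_apply (𝕜 := ℝ) v⟩

theorem integrable_corrKernel {b : E3 → ℝ} (hb : LocallyIntegrable b) {χ φ : E3 → Spin}
    (hχ : IsTestFunction χ) (hφ : IsTestFunction φ) (s : E3) :
    Integrable fun r => b r • corrKernel χ φ s r := by
  obtain ⟨R, hR⟩ := exists_corrKernel_support hχ hφ
  refine hb.integrable_smul_right_of_hasCompactSupport ?_ ?_
  · exact (continuous_corrKernel hχ hφ).comp (Continuous.prodMk_right s)
  · refine HasCompactSupport.intro (isCompact_closedBall (0 : E3) R) fun r hr => ?_
    by_contra h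
    exact hr (by simpa using (hR _ _ h).1)

theorem fderiv_corr {b : E3 → ℝ} (hb : LocallyIntegrable b) {χ φ : E3 → Spin}
    (hχ : IsTestFunction χ) (hφ : IsTestFunction φ) (s v : E3) :
    fderiv ℝ (corr b χ φ) s v =
      (1 / 2 : ℝ) • (corr b (dirDeriv v χ) φ s - corr b χ (dirDeriv v φ) s) := by
  obtain ⟨R, hR⟩ := exists_corrKernel_support hχ hφ
  obtain ⟨R₁, hR₁⟩ := exists_corrKernel_support (hχ.dirDeriv v) hφ
  obtain ⟨R₂, hR₂⟩ := exists_corrKernel_support hχ (hφ.dirDeriv v)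
  obtain ⟨C₁, hC₁⟩ := exists_corrKernel_bound (hχ.dirDeriv v) hφ
  obtain ⟨C₂, hC₂⟩ := exists_corrKernel_bound hχ (hφ.dirDeriv v)
  let F' : ℝ → E3 → ℂ := fun τ r => b r • ((1 / 2 : ℝ) •
    (corrKernel (dirDeriv v χ) φ (s + τ • v) r - corrKernel χ (dirDeriv v φ) (s + τ • v) r))
  have hF'0 : F' 0 = fun r => (1 / 2 : ℝ) • (b r • corrKernel (dirDeriv v χ) φ s r -
      b r • corrKernel χ (dirDeriv v φ) s r) := by
    ext r
    simp only [F', zero_smul, add_zero]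
    rw [smul_comm (b r) (1 / 2 : ℝ) (_ : ℂ), smul_sub (b r) (_ : ℂ)]
  have hint : Integrable (F' 0) := by
    rw [hF'0]
    exact ((integrable_corrKernel hb (hχ.dirDeriv v) hφ s).sub
      (integrable_corrKernel hb hχ (hφ.dirDeriv v) s)).smul (1 / 2 : ℝ)
  have h1 : HasDerivAt (fun τ : ℝ => corr b χ φ (s + τ • v)) (∫ r, F' 0 r) 0 := by
    -- Both kernels vanish outside one ball in `r`, whatever `τ` is; on it `b` is integrable and the
    -- kernels are bounded.
    refine (hasDerivAt_integral_of_dominated_loc_of_deriv_le (s := Set.univ) (F' := F')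
      (bound := (Metric.closedBall (0 : E3) (max R₁ R₂)).indicator
        fun r => ‖b r‖ * (1 / 2 * (C₁ + C₂))) univ_mem
      (Eventually.of_forall fun τ => (integrable_corrKernel hb hχ hφ _).aestronglyMeasurable)
      (integrable_corrKernel hb hχ hφ _) hint.aestronglyMeasurable
      (Eventually.of_forall fun r τ _ => ?_) ?_ (Eventually.of_forall fun r τ _ => ?_)).2
    · by_cases hr : r ∈ Metric.closedBall (0 : E3) (max R₁ R₂)
      · rw [Set.indicator_of_mem hr]
        simp only [F', norm_smul]
        rw [Real.norm_of_nonneg (by norm_num : (0 : ℝ) ≤ 1 / 2)]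
        gcongr
        exact (norm_sub_le _ _).trans (add_le_add (hC₁ _ _) (hC₂ _ _))
      · rw [Set.indicator_of_notMem hr]
        have hr' : max R₁ R₂ < ‖r‖ := by simpa using hr
        have e₁ : corrKernel (dirDeriv v χ) φ (s + τ • v) r = 0 := by
          by_contra h
          exact ((hR₁ _ _ h).1.trans (le_max_left _ _)).not_gt hr'
        have e₂ : corrKernel χ (dirDeriv v φ) (s + τ • v) r = 0 := by
          by_contra h
          exact ((hR₂ _ _ h).1.trans (le_max_right _ _)).not_gt hr'
        simp [F', e₁, e₂]
    · rw [integrable_indicator_iff measurableSet_closedBall]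
      exact ((hb.integrableOn_isCompact (isCompact_closedBall _ _)).norm).mul_const _
    · refine HasDerivAt.const_smul (b r) ?_
      have hs : HasDerivAt (fun τ : ℝ => s + τ • v) v τ := by
        simpa using ((hasDerivAt_id τ).smul_const v).const_add s
      have hx : HasDerivAt (fun τ : ℝ => χ (r + (1 / 2 : ℝ) • (s + τ • v)))
          (fderiv ℝ χ (r + (1 / 2 : ℝ) • (s + τ • v)) ((1 / 2 : ℝ) • v)) τ :=
        ((hχ.1.differentiable (by simp)) _).hasFDerivAt.comp_hasDerivAt τ
          ((hs.const_smul (1 / 2 : ℝ)).const_add r)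
      have hy : HasDerivAt (fun τ : ℝ => φ (r - (1 / 2 : ℝ) • (s + τ • v)))
          (fderiv ℝ φ (r - (1 / 2 : ℝ) • (s + τ • v)) (-((1 / 2 : ℝ) • v))) τ :=
        ((hφ.1.differentiable (by simp)) _).hasFDerivAt.comp_hasDerivAt τ
          ((hs.const_smul (1 / 2 : ℝ)).const_sub r)
      convert! hx.inner ℂ hy using 1
      simp only [corrKernel, dirDeriv, map_neg, map_smul, inner_neg_right]
      rw [inner_smul_left_eq_smul, inner_smul_right_eq_smul]
      module
  have h2 := (((contDiff_corr hb hχ hφ).differentiable (by simp)) s).hasFDerivAt.hasLineDerivAt v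
  have h3 := h2.unique h1
  rw [h3, hF'0, integral_smul, integral_sub (integrable_corrKernel hb (hχ.dirDeriv v) hφ s)
    (integrable_corrKernel hb hχ (hφ.dirDeriv v) s)]
  rfl

/-! ### Centre-of-mass and relative coordinates -/

/-- The map `(r, s) ↦ (r + s/2, r - s/2)`. -/
def relCoord (q : E3 × E3) : E3 × E3 := (q.1 + (1 / 2 : ℝ) • q.2, q.1 - (1 / 2 : ℝ) • q.2)

/-- The map factors into two shears, conjugated by swaps, and each factor preserves Lebesgue
measure. -/
theorem measurePreserving_relCoord : MeasurePreserving relCoord := by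
  have hswap : MeasurePreserving (Prod.swap : E3 × E3 → E3 × E3) := Measure.measurePreserving_swap
  have h1 : MeasurePreserving (fun q : E3 × E3 => (q.1, q.2 - (1 / 2 : ℝ) • q.1)) :=
    (MeasurePreserving.id volume).skew_product (by fun_prop)
      (Eventually.of_forall fun s => (measurePreserving_sub_right volume ((1 / 2 : ℝ) • s)).map_eq)
  have h2 : MeasurePreserving (fun q : E3 × E3 => (q.1, q.2 + q.1)) :=
    (MeasurePreserving.id volume).skew_product (by fun_prop)
      (Eventually.of_forall fun s => (measurePreserving_add_right volume s).map_eq)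
  convert hswap.comp (h2.comp (hswap.comp (h1.comp hswap))) using 1
  ext1 q
  simp only [relCoord, Function.comp_apply, Prod.swap_prod_mk, Prod.fst_swap, Prod.snd_swap]
  congr 1
  module

theorem measurableEmbedding_relCoord : MeasurableEmbedding relCoord := by
  refine Continuous.measurableEmbedding (by unfold relCoord; fun_prop) fun q q' h => ?_
  obtain ⟨h1, h2⟩ := Prod.mk.inj h
  have hr : ∀ q : E3 × E3, q.1 = (1 / 2 : ℝ) • ((q.1 + (1 / 2 : ℝ) • q.2) +
    (q.1 - (1 / 2 : ℝ) • q.2)) := fun q => by module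
  have hs : ∀ q : E3 × E3, q.2 = (q.1 + (1 / 2 : ℝ) • q.2) - (q.1 - (1 / 2 : ℝ) • q.2) :=
    fun q => by module
  ext1
  · rw [hr q, hr q', h1, h2]
  · rw [hs q, hs q', h1, h2]

theorem midpoint_relCoord (q : E3 × E3) : midpoint ℝ (relCoord q).1 (relCoord q).2 = q.1 := by
  rw [midpoint_eq_smul_add, relCoord, invOf_eq_inv]
  module

theorem relCoord_fst_sub_snd (q : E3 × E3) : (relCoord q).1 - (relCoord q).2 = q.2 := by
  rw [relCoord]
  module

/-- The oscillating factor `e^{i s·p/ħ}`. -/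
def phase (hbar : ℝ) (p s : E3) : ℂ :=
  Complex.exp (Complex.I / (hbar : ℂ) * ((inner ℝ s p : ℝ) : ℂ))

theorem continuous_phase (hbar : ℝ) (p : E3) : Continuous (phase hbar p) := by
  unfold phase; fun_prop

theorem norm_phase (hbar : ℝ) (p s : E3) : ‖phase hbar p s‖ = 1 := by
  have : Complex.I / (hbar : ℂ) * ((inner ℝ s p : ℝ) : ℂ) =
      ((inner ℝ s p / hbar : ℝ) : ℂ) * Complex.I := by push_cast; ring
  rw [phase, this, Complex.norm_exp_ofReal_mul_I]

/-- The integrand of the Weyl quantization of the scalar function `b`. -/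
def scalarIntegrand (hbar : ℝ) (b : E3 → ℝ) (χ φ : E3 → Spin) (p : E3) (z : E3 × E3) : ℂ :=
  b (midpoint ℝ z.1 z.2) • inner ℂ (χ z.1) (φ z.2) * phase hbar p (z.1 - z.2)

theorem scalarIntegrand_relCoord (hbar : ℝ) (b : E3 → ℝ) (χ φ : E3 → Spin) (p : E3)
    (q : E3 × E3) : scalarIntegrand hbar b χ φ p (relCoord q) =
      b q.1 • corrKernel χ φ q.2 q.1 * phase hbar p q.2 := by
  rw [scalarIntegrand, midpoint_relCoord, relCoord_fst_sub_snd]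
  rfl

theorem integrable_relCoord (hbar : ℝ) {b : E3 → ℝ} (hb : LocallyIntegrable b)
    {χ φ : E3 → Spin} (hχ : IsTestFunction χ) (hφ : IsTestFunction φ) (p : E3) :
    Integrable fun q : E3 × E3 => b q.1 • corrKernel χ φ q.2 q.1 * phase hbar p q.2 := by
  obtain ⟨R, hR⟩ := exists_corrKernel_support hχ hφ
  obtain ⟨C, hC⟩ := exists_corrKernel_bound hχ hφ
  let B := Metric.closedBall (0 : E3) R
  have h1 : Integrable (B.indicator fun r => (b r : ℂ)) := by
    rw [integrable_indicator_iff measurableSet_closedBall]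
    exact (hb.integrableOn_isCompact (isCompact_closedBall _ _)).ofReal
  have h2 : Integrable (B.indicator fun _ => (1 : ℂ)) := by
    rw [integrable_indicator_iff measurableSet_closedBall]
    exact integrableOn_const (isCompact_closedBall _ _).measure_ne_top
  -- The kernel is bounded and supported in `B × B`, so `b` may be cut off to `B` and the variable
  -- `s` confined to `B`.
  have h3 := (h1.mul_prod h2).mul_bdd (c := C)
    (g := fun q : E3 × E3 => corrKernel χ φ q.2 q.1 * phase hbar p q.2) ?_ ?_
  · refine h3.congr (Eventually.of_forall fun q => ?_)
    by_cases h : corrKernel χ φ q.2 q.1 = 0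
    · simp [h]
    · obtain ⟨h4, h5⟩ := hR _ _ h
      have h4 : q.1 ∈ B := by simpa [B] using h4
      have h5 : q.2 ∈ B := by simpa [B] using h5
      simp only [Set.indicator_of_mem h4, Set.indicator_of_mem h5, Complex.real_smul]
      ring
  · exact (((continuous_corrKernel hχ hφ).comp continuous_swap).mul
      ((continuous_phase hbar p).comp continuous_snd)).aestronglyMeasurable
  · refine Eventually.of_forall fun q => ?_
    rw [norm_mul, norm_phase, mul_one]
    exact hC _ _

theorem integrable_scalarIntegrand (hbar : ℝ) {b : E3 → ℝ} (hb : LocallyIntegrable b)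
    {χ φ : E3 → Spin} (hχ : IsTestFunction χ) (hφ : IsTestFunction φ) (p : E3) :
    Integrable (scalarIntegrand hbar b χ φ p) := by
  rw [← measurePreserving_relCoord.integrable_comp_emb measurableEmbedding_relCoord]
  refine (integrable_relCoord hbar hb hχ hφ p).congr (Eventually.of_forall fun q => ?_)
  exact (scalarIntegrand_relCoord hbar b χ φ p q).symm

/-- The function `p ↦ ∫ G(s) e^{i s·p/ħ} ds`. -/
def oscInt (hbar : ℝ) (G : E3 → ℂ) (p : E3) : ℂ := ∫ s, G s * phase hbar p s

/-- The weight depends on `r` only and the phase on `s` only, so Fubini, integrating `r` first,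
leaves a Fourier integral in `s`. -/
theorem integral_scalarIntegrand (hbar : ℝ) {b : E3 → ℝ} (hb : LocallyIntegrable b)
    {χ φ : E3 → Spin} (hχ : IsTestFunction χ) (hφ : IsTestFunction φ) (p : E3) :
    ∫ z, scalarIntegrand hbar b χ φ p z = oscInt hbar (corr b χ φ) p := by
  rw [← measurePreserving_relCoord.integral_comp measurableEmbedding_relCoord]
  simp only [scalarIntegrand_relCoord]
  erw [integral_prod_symm _ (integrable_relCoord hbar hb hχ hφ p)]
  refine integral_congr_ae (Eventually.of_forall fun s => ?_)
  exact integral_mul_const (phase hbar p s) fun r => b r • corrKernel χ φ s r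

/-! ### Fourier inversion -/

theorem oscInt_eq_fourierInv {hbar : ℝ} (hh : 0 < hbar) (G : 𝓢(E3, ℂ)) (p : E3) :
    oscInt hbar G p = (𝓕⁻ G) ((2 * Real.pi * hbar)⁻¹ • p) := by
  rw [fourierInv_coe, Real.fourierInv_eq', oscInt]
  refine integral_congr_ae (Eventually.of_forall fun s => ?_)
  simp only [phase, smul_eq_mul, inner_smul_right]
  rw [mul_comm]
  congr 2
  have := hh.ne'
  have := Real.pi_ne_zero
  push_cast
  field_simp

theorem integrable_oscInt {hbar : ℝ} (hh : 0 < hbar) (G : 𝓢(E3, ℂ)) :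
    Integrable (oscInt hbar G) := by
  have : oscInt hbar G = fun p => (𝓕⁻ G) ((2 * Real.pi * hbar)⁻¹ • p) :=
    funext (oscInt_eq_fourierInv hh G)
  rw [this]
  exact (𝓕⁻ G).integrable.comp_smul (by positivity)

/-- Fourier inversion at the origin. The factor is the Jacobian in dimension three of `p ↦ p/(2πħ)`,
the scaling between the phase `e^{i s·p/ħ}` and the kernel `e^{2πi s·ξ}`; it cancels the prefactor
of the Weyl formula. -/
theorem integral_oscInt {hbar : ℝ} (hh : 0 < hbar) (G : 𝓢(E3, ℂ)) :
    ∫ p, oscInt hbar G p = ((2 * Real.pi * hbar) ^ 3 : ℝ) * G 0 := by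
  have h0 : ∫ ξ, (𝓕⁻ G) ξ = G 0 := by
    have : 𝓕 (𝓕⁻ G) 0 = G 0 := by rw [fourier_fourierInv_eq]
    rw [← this, fourier_coe, Real.fourier_eq']
    simp
  simp only [oscInt_eq_fourierInv hh]
  rw [Measure.integral_comp_smul, h0]
  simp only [finrank_euclideanSpace, Fintype.card_fin, inv_pow, inv_inv]
  rw [abs_of_pos (by positivity), Complex.real_smul]

theorem mul_oscInt {hbar : ℝ} (hh : 0 < hbar) (G : 𝓢(E3, ℂ)) (j : Fin 3) (p : E3) :
    (p j : ℂ) * oscInt hbar G p = Complex.I * hbar * oscInt hbar (∂_{stdVec j} G : 𝓢(E3, ℂ)) p := by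
  rw [oscInt_eq_fourierInv hh, oscInt_eq_fourierInv hh, fourierInv_lineDerivOp_eq, smul_apply,
    smulLeftCLM_apply_apply (by fun_prop)]
  have h1 : (hbar : ℂ) ≠ 0 := by exact_mod_cast hh.ne'
  have h2 : (Real.pi : ℂ) ≠ 0 := by exact_mod_cast Real.pi_ne_zero
  simp only [inner_smul_left, stdVec, EuclideanSpace.inner_single_right]
  generalize (𝓕⁻ G) ((2 * Real.pi * hbar)⁻¹ • p) = w
  simp only [conj_trivial, one_mul, Complex.real_smul, smul_eq_mul]
  push_cast
  field_simp
  rw [Complex.I_sq]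
  ring

/-! ### Multiplication operators -/

/-- The action of a constant matrix on spinors. -/
def matOp (S : Matrix (Fin 2) (Fin 2) ℂ) : Spin →L[ℂ] Spin := Matrix.toEuclideanCLM (𝕜 := ℂ) S

theorem matOp_apply (S : Matrix (Fin 2) (Fin 2) ℂ) (v : Spin) :
    matOp S v = WithLp.toLp 2 (S *ᵥ v.ofLp) := rfl

theorem lineDeriv_postcomp (S : Spin →L[ℂ] Spin) (f : 𝓢(E3, Spin)) (v : E3) :
    (∂_{v} (postcompCLM S f) : 𝓢(E3, Spin)) = postcompCLM S (∂_{v} f) := by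
  ext1 x
  rw [postcompCLM_apply, lineDerivOp_apply_eq_fderiv, lineDerivOp_apply_eq_fderiv]
  have h : HasFDerivAt (fun y => S (f y)) ((S.restrictScalars ℝ).comp (fderiv ℝ f x)) x :=
    (S.restrictScalars ℝ).hasFDerivAt.comp x f.differentiableAt.hasFDerivAt
  exact congrArg (· v) h.fderiv

theorem norm_emb_postcomp_le (S : Spin →L[ℂ] Spin) (f : 𝓢(E3, Spin)) :
    ‖emb (postcompCLM S f)‖ ≤ ‖S‖ * ‖emb f‖ := by
  refine Lp.norm_le_mul_norm_of_ae_le_mul ?_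
  filter_upwards [coeFn_emb f, coeFn_emb (postcompCLM S f)] with x h1 h2
  rw [h1, h2, postcompCLM_apply]
  exact S.le_opNorm _

/-- Multiplication by a bounded real function on `L²(ℝ³; ℂ²)`. -/
def mulOp {b : E3 → ℝ} (hb : MemLp b ∞) : L2Spin →ₗ[ℂ] L2Spin where
  toFun u := ((Lp.memLp u).smul (r := 2) hb).toLp (b • ⇑u)
  map_add' u v := by
    rw [← MemLp.toLp_add]
    refine MemLp.toLp_congr _ _ ?_
    filter_upwards [Lp.coeFn_add u v] with x hx
    simp only [Pi.smul_apply', hx, Pi.add_apply, smul_add]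
  map_smul' c u := by
    rw [← MemLp.toLp_const_smul]
    refine MemLp.toLp_congr _ _ ?_
    filter_upwards [Lp.coeFn_smul c u] with x hx
    simp only [Pi.smul_apply', hx, Pi.smul_apply, RingHom.id_apply]
    exact smul_comm _ _ _

theorem coeFn_mulOp {b : E3 → ℝ} (hb : MemLp b ∞) (u : L2Spin) :
    mulOp hb u =ᵐ[volume] fun x => b x • u x :=
  ((Lp.memLp u).smul (r := 2) hb).coeFn_toLp

theorem exists_norm_mulOp_le {b : E3 → ℝ} (hb : MemLp b ∞) :
    ∃ C, 0 ≤ C ∧ ∀ u, ‖mulOp hb u‖ ≤ C * ‖u‖ := by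
  refine ⟨(eLpNorm b ∞ volume).toReal, ENNReal.toReal_nonneg, fun u => ?_⟩
  refine Lp.norm_le_mul_norm_of_ae_le_mul ?_
  have h : ∀ᵐ x, ‖b x‖ ≤ (eLpNorm b ∞ volume).toReal := by
    filter_upwards [ae_le_eLpNormEssSup (f := b) (μ := (volume : Measure E3))] with x hx
    rw [← eLpNorm_exponent_top] at hx
    simpa using ENNReal.toReal_mono hb.2.ne hx
  filter_upwards [coeFn_mulOp hb u, h] with x h1 h2
  rw [h1, norm_smul]
  gcongr

/-! ### Operators of a Weyl symbol -/

theorem isTestFunction_of_mem {f : 𝓢(E3, Spin)} (hf : f ∈ testSchwartz) : IsTestFunction f :=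
  ⟨f.smooth ⊤, hf⟩

theorem postcomp_mem {f : 𝓢(E3, Spin)} (hf : f ∈ testSchwartz) (S : Spin →L[ℂ] Spin) :
    postcompCLM S f ∈ testSchwartz :=
  HasCompactSupport.comp_left (g := S) hf (map_zero S)

/-- The sesquilinear form of the Weyl quantization of the symbol `a` is that of the operator `H`,
defined on Schwartz functions. -/
def HasWeylForm (hbar : ℝ) (a : E3 → E3 → Matrix (Fin 2) (Fin 2) ℂ)
    (H : 𝓢(E3, Spin) →ₗ[ℂ] L2Spin) : Prop :=
  ∀ χ ∈ testSchwartz, ∀ φ ∈ testSchwartz,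
    (∀ p, Integrable (weylIntegrand hbar a χ φ p)) ∧
    Integrable (fun p => ∫ z, weylIntegrand hbar a χ φ p z) ∧
    inner ℂ (emb χ) (H φ) =
      (((2 * Real.pi * hbar) ^ 3)⁻¹ : ℝ) * ∫ p, ∫ z, weylIntegrand hbar a χ φ p z

theorem weylIntegrand_add (hbar : ℝ) (a a' : E3 → E3 → Matrix (Fin 2) (Fin 2) ℂ)
    (χ φ : E3 → Spin) (p : E3) : weylIntegrand hbar (a + a') χ φ p =
      weylIntegrand hbar a χ φ p + weylIntegrand hbar a' χ φ p := by
  ext1 z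
  simp only [weylIntegrand, Pi.add_apply, Matrix.add_mulVec, WithLp.toLp_add, inner_add_right,
    add_mul]

theorem HasWeylForm.add {hbar : ℝ} {a a' : E3 → E3 → Matrix (Fin 2) (Fin 2) ℂ}
    {H H' : 𝓢(E3, Spin) →ₗ[ℂ] L2Spin} (h : HasWeylForm hbar a H) (h' : HasWeylForm hbar a' H') :
    HasWeylForm hbar (a + a') (H + H') := by
  intro χ hχ φ hφ
  obtain ⟨h1, h2, h3⟩ := h χ hχ φ hφ
  obtain ⟨h1', h2', h3'⟩ := h' χ hχ φ hφ
  have key : ∀ p, ∫ z, weylIntegrand hbar (a + a') χ φ p z =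
      (∫ z, weylIntegrand hbar a χ φ p z) + ∫ z, weylIntegrand hbar a' χ φ p z := fun p => by
    rw [weylIntegrand_add]
    exact integral_add (h1 p) (h1' p)
  refine ⟨fun p => ?_, ?_, ?_⟩
  · rw [weylIntegrand_add]
    exact (h1 p).add (h1' p)
  · simp only [key]
    exact h2.add h2'
  · simp only [key]
    rw [integral_add h2 h2', mul_add, ← h3, ← h3', LinearMap.add_apply, inner_add_right]

theorem hasWeylForm_zero (hbar : ℝ) : HasWeylForm hbar 0 0 := by
  intro χ _ φ _
  have : ∀ p, weylIntegrand hbar 0 χ φ p = 0 := fun p => by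
    ext1 z
    simp [weylIntegrand]
  simp [this, integrable_zero]

theorem HasWeylForm.sum {hbar : ℝ} {ι : Type*} (s : Finset ι)
    {a : ι → E3 → E3 → Matrix (Fin 2) (Fin 2) ℂ} {H : ι → 𝓢(E3, Spin) →ₗ[ℂ] L2Spin}
    (h : ∀ i, HasWeylForm hbar (a i) (H i)) :
    HasWeylForm hbar (∑ i ∈ s, a i) (∑ i ∈ s, H i) := by
  classical
  induction s using Finset.induction_on with
  | empty => simpa using hasWeylForm_zero hbar
  | insert i s hi ih =>
    rw [Finset.sum_insert hi, Finset.sum_insert hi]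
    exact (h i).add ih

/-! ### Scalar symbols that are polynomial in the momentum -/

/-- The correlation function of two test functions as a Schwartz function. -/
def corrSchwartz {b : E3 → ℝ} (hb : LocallyIntegrable b) {χ φ : E3 → Spin}
    (hχ : IsTestFunction χ) (hφ : IsTestFunction φ) : 𝓢(E3, ℂ) :=
  (hasCompactSupport_corr b hχ hφ).toSchwartzMap (contDiff_corr hb hχ hφ)

theorem lineDeriv_corrSchwartz {b : E3 → ℝ} (hb : LocallyIntegrable b) {χ φ : E3 → Spin}
    (hχ : IsTestFunction χ) (hφ : IsTestFunction φ) (v : E3) :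
    ∂_{v} (corrSchwartz hb hχ hφ) = (1 / 2 : ℝ) •
      (corrSchwartz hb (hχ.dirDeriv v) hφ - corrSchwartz hb hχ (hφ.dirDeriv v)) := by
  ext1 s
  rw [lineDerivOp_apply_eq_fderiv]
  exact fderiv_corr hb hχ hφ s v

theorem lineDeriv_corrSchwartz_apply {b : E3 → ℝ} (hb : LocallyIntegrable b) {χ φ : E3 → Spin}
    (hχ : IsTestFunction χ) (hφ : IsTestFunction φ) (v s : E3) :
    (∂_{v} (corrSchwartz hb hχ hφ) : 𝓢(E3, ℂ)) s =
      (1 / 2 : ℝ) • (corr b (dirDeriv v χ) φ s - corr b χ (dirDeriv v φ) s) :=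
  fderiv_corr hb hχ hφ s v

theorem lineDeriv_lineDeriv_corrSchwartz_apply {b : E3 → ℝ} (hb : LocallyIntegrable b)
    {χ φ : E3 → Spin} (hχ : IsTestFunction χ) (hφ : IsTestFunction φ) (v s : E3) :
    (∂_{v} (∂_{v} (corrSchwartz hb hχ hφ)) : 𝓢(E3, ℂ)) s =
      (1 / 4 : ℝ) • (corr b (dirDeriv v (dirDeriv v χ)) φ s -
        2 * corr b (dirDeriv v χ) (dirDeriv v φ) s + corr b χ (dirDeriv v (dirDeriv v φ)) s) := by
  rw [lineDeriv_corrSchwartz, lineDerivOp_smul, sub_eq_add_neg, lineDerivOp_add, lineDerivOp_neg,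
    smul_apply, add_apply, neg_apply, lineDeriv_corrSchwartz_apply, lineDeriv_corrSchwartz_apply]
  simp only [Complex.real_smul]
  push_cast
  ring

/-- A symbol whose Weyl form is, for all `p`, the oscillatory integral of a Schwartz function. -/
theorem hasWeylForm_of_oscInt {hbar : ℝ} (hh : 0 < hbar)
    {a : E3 → E3 → Matrix (Fin 2) (Fin 2) ℂ} {H : 𝓢(E3, Spin) →ₗ[ℂ] L2Spin}
    (h : ∀ χ ∈ testSchwartz, ∀ φ ∈ testSchwartz, (∀ p, Integrable (weylIntegrand hbar a χ φ p)) ∧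
      ∃ G : 𝓢(E3, ℂ), (∀ p, ∫ z, weylIntegrand hbar a χ φ p z = oscInt hbar G p) ∧
        inner ℂ (emb χ) (H φ) = G 0) :
    HasWeylForm hbar a H := by
  intro χ hχ φ hφ
  obtain ⟨h1, G, h2, h3⟩ := h χ hχ φ hφ
  refine ⟨h1, ?_, ?_⟩
  · simp only [h2]
    exact integrable_oscInt hh G
  · simp only [h2]
    rw [integral_oscInt hh, h3, ← mul_assoc, ← Complex.ofReal_mul,
      inv_mul_cancel₀ (by positivity), Complex.ofReal_one, one_mul]

/-- A constant matrix can be absorbed into `φ`, and a factor in `p` alone leaves the inner integral.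
This reduces matrix symbols to scalar weights. -/
theorem weylIntegrand_smul (hbar : ℝ) (w : E3 → ℂ) (b : E3 → ℝ) (S : Matrix (Fin 2) (Fin 2) ℂ)
    (χ φ : 𝓢(E3, Spin)) (p : E3) :
    weylIntegrand hbar (fun r p => (w p * b r) • S) χ φ p =
      fun z => w p * scalarIntegrand hbar b χ (postcompCLM (matOp S) φ) p z := by
  ext1 z
  simp only [weylIntegrand, scalarIntegrand, Matrix.smul_mulVec, WithLp.toLp_smul, inner_smul_right,
    postcompCLM_apply, matOp_apply, Complex.real_smul, phase]
  ring

theorem corr_apply_zero (b : E3 → ℝ) (χ φ : E3 → Spin) :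
    corr b χ φ 0 = ∫ r, b r • inner ℂ (χ r) (φ r) := by
  simp [corr, corrKernel]

theorem inner_emb_mulOp {b : E3 → ℝ} (hb : MemLp b ∞) (χ φ : 𝓢(E3, Spin)) :
    inner ℂ (emb χ) (mulOp hb (emb φ)) = corr b χ φ 0 := by
  rw [corr_apply_zero, L2.inner_def]
  refine integral_congr_ae ?_
  filter_upwards [coeFn_emb χ, coeFn_mulOp hb (emb φ), coeFn_emb φ] with x h1 h2 h3
  rw [h1, h2, h3, inner_smul_right_eq_smul]

theorem inner_emb_emb_eq_corr (χ φ : 𝓢(E3, Spin)) :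
    inner ℂ (emb χ) (emb φ) = corr (fun _ => 1) χ φ 0 := by
  simp [corr_apply_zero, inner_emb_emb]

/-- The operator of the symbol `b(x) S`. -/
theorem hasWeylForm_mul {hbar : ℝ} (hh : 0 < hbar) {b : E3 → ℝ} (hb : MemLp b ∞)
    (hb' : LocallyIntegrable b) (S : Matrix (Fin 2) (Fin 2) ℂ) :
    HasWeylForm hbar (fun r _ => (b r : ℂ) • S)
      (mulOp hb ∘ₗ (emb ∘L postcompCLM (matOp S) : 𝓢(E3, Spin) →L[ℂ] L2Spin)) := by
  refine hasWeylForm_of_oscInt hh fun χ hχ φ hφ => ?_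
  have tχ := isTestFunction_of_mem hχ
  have tφ := isTestFunction_of_mem (postcomp_mem hφ (matOp S))
  have key := weylIntegrand_smul hbar (fun _ => 1) b S χ φ
  simp only [one_mul] at key
  refine ⟨fun p => ?_, corrSchwartz hb' tχ tφ, fun p => ?_, ?_⟩
  · rw [key]
    exact integrable_scalarIntegrand hbar hb' tχ tφ p
  · rw [key]
    exact integral_scalarIntegrand hbar hb' tχ tφ p
  · exact inner_emb_mulOp hb χ _

/-- Leibniz rule with a weakly differentiable weight. -/
theorem corr_dirDeriv_add {b b' : E3 → ℝ} {j : Fin 3} (hb : HasWeakDeriv (fun _ : Fin 1 => j) b b')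
    {χ φ : E3 → Spin} (hχ : IsTestFunction χ) (hφ : IsTestFunction φ) :
    corr b (dirDeriv (stdVec j) χ) φ 0 + corr b χ (dirDeriv (stdVec j) φ) 0 = -corr b' χ φ 0 := by
  obtain ⟨hb1, hb2, hb3⟩ := hb
  let θ : E3 → ℂ := fun r => inner ℂ (χ r) (φ r)
  have hθ : ContDiff ℝ ∞ θ := hχ.1.inner ℂ hφ.1
  have hθ' : HasCompactSupport θ := by
    refine hφ.2.mono' (subset_trans (fun x hx => ?_) (subset_tsupport φ))
    intro h0
    exact hx (by simp [θ, h0])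
  have hd : ∀ r, fderiv ℝ θ r (stdVec j) =
      inner ℂ (dirDeriv (stdVec j) χ r) (φ r) + inner ℂ (χ r) (dirDeriv (stdVec j) φ r) := by
    intro r
    rw [add_comm]
    exact fderiv_inner_apply ℂ ((hχ.1.differentiable (by simp)) r)
      ((hφ.1.differentiable (by simp)) r) _
  -- The weak derivative is tested against real functions only, so it is applied to the images of
  -- `θ` under real functionals, later the real and imaginary parts.
  have hlin : ∀ L : ℂ →L[ℝ] ℝ,
      ∫ r, b r • L (fderiv ℝ θ r (stdVec j)) = -∫ r, b' r • L (θ r) := by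
    intro L
    have h1 := hb3 (fun r => L (θ r)) (L.contDiff.comp hθ) (hθ'.comp_left (map_zero L))
    simp only [iteratedFDeriv_one_apply, pow_one, neg_mul, one_mul] at h1
    simp only [smul_eq_mul]
    rw [← h1]
    refine integral_congr_ae (Eventually.of_forall fun r => ?_)
    have h2 : HasFDerivAt (fun r => L (θ r)) (L.comp (fderiv ℝ θ r)) r :=
      L.hasFDerivAt.comp r ((hθ.differentiable (by simp)) r).hasFDerivAt
    simp only [h2.fderiv, ContinuousLinearMap.comp_apply]
  have i1 : Integrable fun r => b r • fderiv ℝ θ r (stdVec j) :=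
    hb1.integrable_smul_right_of_hasCompactSupport
      ((hθ.continuous_fderiv (by simp)).clm_apply continuous_const) (hθ'.fderiv_apply (𝕜 := ℝ) _)
  have i2 : Integrable fun r => b' r • θ r :=
    hb2.integrable_smul_right_of_hasCompactSupport hθ.continuous hθ'
  have hmain : ∫ r, b r • fderiv ℝ θ r (stdVec j) = -∫ r, b' r • θ r := by
    have hL : ∀ L : ℂ →L[ℝ] ℝ, L (∫ r, b r • fderiv ℝ θ r (stdVec j)) =
        L (-∫ r, b' r • θ r) := by
      intro L
      rw [map_neg, ← L.integral_comp_comm i1, ← L.integral_comp_comm i2]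
      simpa only [map_smul] using hlin L
    exact Complex.ext (hL Complex.reCLM) (hL Complex.imCLM)
  have i3 := integrable_corrKernel hb1 (hχ.dirDeriv (stdVec j)) hφ 0
  have i4 := integrable_corrKernel hb1 hχ (hφ.dirDeriv (stdVec j)) 0
  rw [corr_apply_zero b', ← hmain, corr, corr, ← integral_add i3 i4]
  refine integral_congr_ae (Eventually.of_forall fun r => ?_)
  simp only [hd, corrKernel, smul_zero, add_zero, sub_zero, smul_add]

theorem coe_lineDeriv (v : E3) (f : 𝓢(E3, Spin)) : ⇑(∂_{v} f : 𝓢(E3, Spin)) = dirDeriv v f := rfl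

/-- The operator of the symbol `p_j b(x) S`. -/
def firstOrderOp (hbar : ℝ) (j : Fin 3) {b b' : E3 → ℝ} (hb : MemLp b ∞) (hb' : MemLp b' ∞)
    (S : Matrix (Fin 2) (Fin 2) ℂ) : 𝓢(E3, Spin) →ₗ[ℂ] L2Spin :=
  (-(Complex.I * hbar)) •
    ((mulOp hb ∘ₗ (emb ∘L lineDerivOpCLM ℂ 𝓢(E3, Spin) (stdVec j) : 𝓢(E3, Spin) →L[ℂ] L2Spin) +
      (1 / 2 : ℂ) • mulOp hb' ∘ₗ (emb : 𝓢(E3, Spin) →ₗ[ℂ] L2Spin)) ∘ₗ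
        (postcompCLM (matOp S) : 𝓢(E3, Spin) →L[ℂ] 𝓢(E3, Spin)))

theorem firstOrderOp_apply (hbar : ℝ) (j : Fin 3) {b b' : E3 → ℝ} (hb : MemLp b ∞)
    (hb' : MemLp b' ∞) (S : Matrix (Fin 2) (Fin 2) ℂ) (f : 𝓢(E3, Spin)) :
    firstOrderOp hbar j hb hb' S f = (-(Complex.I * hbar)) •
      (mulOp hb (emb (∂_{stdVec j} (postcompCLM (matOp S) f))) +
        (1 / 2 : ℂ) • mulOp hb' (emb (postcompCLM (matOp S) f))) := rfl

theorem hasWeylForm_firstOrderOp {hbar : ℝ} (hh : 0 < hbar) (j : Fin 3) {b b' : E3 → ℝ}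
    (hb : MemLp b ∞) (hb' : MemLp b' ∞) (hw : HasWeakDeriv (fun _ : Fin 1 => j) b b')
    (S : Matrix (Fin 2) (Fin 2) ℂ) :
    HasWeylForm hbar (fun r p => ((p j : ℂ) * b r) • S) (firstOrderOp hbar j hb hb' S) := by
  refine hasWeylForm_of_oscInt hh fun χ hχ φ hφ => ?_
  have tχ := isTestFunction_of_mem hχ
  have tφ := isTestFunction_of_mem (postcomp_mem hφ (matOp S))
  have key := weylIntegrand_smul hbar (fun p => (p j : ℂ)) b S χ φ
  refine ⟨fun p => ?_, (Complex.I * hbar) • ∂_{stdVec j} (corrSchwartz hw.1 tχ tφ),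
    fun p => ?_, ?_⟩
  · rw [key]
    exact (integrable_scalarIntegrand hbar hw.1 tχ tφ p).const_mul _
  · have h1 := mul_oscInt hh (corrSchwartz hw.1 tχ tφ) j p
    rw [key, integral_const_mul, integral_scalarIntegrand hbar hw.1 tχ tφ p]
    refine h1.trans ?_
    simp only [oscInt, ← integral_const_mul, smul_apply, smul_eq_mul, mul_assoc]
  · rw [firstOrderOp_apply, inner_smul_right, inner_add_right, inner_smul_right, inner_emb_mulOp,
      inner_emb_mulOp, lineDeriv_corrSchwartz, coe_lineDeriv]
    -- The Weyl rule puts half of the derivative on `χ` and half on `φ`. Moving the first half over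
    -- to `φ` produces the term `½ b'`.
    have h1 := corr_dirDeriv_add hw tχ tφ
    rw [← neg_eq_iff_eq_neg] at h1
    rw [← h1]
    change _ = (Complex.I * hbar) • ((1 / 2 : ℝ) •
      (corr b (dirDeriv (stdVec j) χ) _ 0 - corr b χ (dirDeriv (stdVec j) _) 0))
    rw [smul_eq_mul, Complex.real_smul]
    push_cast
    ring

/-- The operator of the symbol `c p_j²`. -/
theorem hasWeylForm_momentum_sq {hbar : ℝ} (hh : 0 < hbar) (c : ℝ) (j : Fin 3) :
    HasWeylForm hbar (fun _ p => ((c * p j ^ 2 : ℝ) : ℂ) • 1)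
      ((-(c * hbar ^ 2) : ℂ) • (emb ∘L lineDerivOpCLM ℂ 𝓢(E3, Spin) (stdVec j) ∘L
        lineDerivOpCLM ℂ 𝓢(E3, Spin) (stdVec j) : 𝓢(E3, Spin) →L[ℂ] L2Spin)) := by
  refine hasWeylForm_of_oscInt hh fun χ hχ φ hφ => ?_
  have tχ := isTestFunction_of_mem hχ
  have tφ := isTestFunction_of_mem hφ
  have hb : LocallyIntegrable (fun _ : E3 => (1 : ℝ)) := locallyIntegrable_const 1
  have key := weylIntegrand_smul hbar (fun p => ((c * p j ^ 2 : ℝ) : ℂ)) (fun _ => 1) 1 χ φ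
  have hid : postcompCLM (matOp 1) φ = φ := by
    ext1 x
    simp [postcompCLM_apply, matOp_apply]
  simp only [Complex.ofReal_one, mul_one, hid] at key
  let v := stdVec j
  refine ⟨fun p => ?_, (-(c * hbar ^ 2) : ℂ) • ∂_{v} (∂_{v} (corrSchwartz hb tχ tφ)),
    fun p => ?_, ?_⟩
  · rw [key]
    exact (integrable_scalarIntegrand hbar hb tχ tφ p).const_mul _
  · have h1 := mul_oscInt hh (corrSchwartz hb tχ tφ) j p
    have h2 := mul_oscInt hh (∂_{v} (corrSchwartz hb tχ tφ)) j p
    rw [key, integral_const_mul, integral_scalarIntegrand hbar hb tχ tφ p]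
    have h3 : oscInt hbar ((-(c * hbar ^ 2) : ℂ) • ∂_{v} (∂_{v} (corrSchwartz hb tχ tφ)) : 𝓢(E3, ℂ)) p
        = (-(c * hbar ^ 2) : ℂ) * oscInt hbar (∂_{v} (∂_{v} (corrSchwartz hb tχ tφ)) : 𝓢(E3, ℂ)) p := by
      simp only [oscInt, ← integral_const_mul, smul_apply, smul_eq_mul, mul_assoc]
    rw [h3]
    have h4 : oscInt hbar (corr (fun _ => 1) χ φ) p = oscInt hbar (corrSchwartz hb tχ tφ) p := rfl
    rw [h4]
    push_cast
    linear_combination (c * p j : ℂ) * h1 + (c * Complex.I * hbar : ℂ) * h2 +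
      (c * hbar ^ 2 * oscInt hbar (∂_{v} (∂_{v} (corrSchwartz hb tχ tφ)) : 𝓢(E3, ℂ)) p) *
        Complex.I_sq
  · have h1 := inner_lineDeriv_right χ (∂_{v} φ) v
    have h2 := inner_lineDeriv_right (∂_{v} χ) φ v
    -- With unit weight the three terms of the second derivative, with coefficients `¼, -½, ¼`, all
    -- equal multiples of the left side after integration by parts, and the multiples add up to one.
    have h3 : inner ℂ (emb χ) (emb (∂_{v} (∂_{v} φ))) =
        (∂_{v} (∂_{v} (corrSchwartz hb tχ tφ)) : 𝓢(E3, ℂ)) 0 := by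
      rw [lineDeriv_lineDeriv_corrSchwartz_apply, ← coe_lineDeriv, ← coe_lineDeriv,
        ← coe_lineDeriv, ← coe_lineDeriv, ← inner_emb_emb_eq_corr, ← inner_emb_emb_eq_corr,
        ← inner_emb_emb_eq_corr, Complex.real_smul]
      push_cast
      linear_combination (1 / 2 : ℂ) * h1 - (1 / 4 : ℂ) * h2 + (1 / 4 : ℂ) * h1
    exact (inner_smul_right _ _ _).trans (congrArg ((-(c * hbar ^ 2) : ℂ) * ·) h3)

/-! ### First order perturbations of the Laplacian -/

/-- `V` is bounded relative to the first order derivatives. -/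
def FirstOrderBounded (V : 𝓢(E3, Spin) →ₗ[ℂ] L2Spin) : Prop :=
  ∃ C, 0 ≤ C ∧ ∀ f, ‖V f‖ ≤ C * (‖emb f‖ + ∑ j, ‖emb (∂_{stdVec j} f)‖)

theorem FirstOrderBounded.add {V V' : 𝓢(E3, Spin) →ₗ[ℂ] L2Spin} (h : FirstOrderBounded V)
    (h' : FirstOrderBounded V') : FirstOrderBounded (V + V') := by
  obtain ⟨C, hC, h⟩ := h
  obtain ⟨C', hC', h'⟩ := h'
  refine ⟨C + C', by positivity, fun f => (norm_add_le _ _).trans ?_⟩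
  rw [add_mul]
  exact add_le_add (h f) (h' f)

theorem FirstOrderBounded.sum {ι : Type*} (s : Finset ι) {V : ι → 𝓢(E3, Spin) →ₗ[ℂ] L2Spin}
    (h : ∀ i, FirstOrderBounded (V i)) : FirstOrderBounded (∑ i ∈ s, V i) := by
  classical
  induction s using Finset.induction_on with
  | empty => exact ⟨0, le_rfl, fun f => by simp⟩
  | insert i s hi ih =>
    rw [Finset.sum_insert hi]
    exact (h i).add ih

theorem firstOrderBounded_mul {b : E3 → ℝ} (hb : MemLp b ∞) (S : Spin →L[ℂ] Spin) :
    FirstOrderBounded (mulOp hb ∘ₗ (emb ∘L postcompCLM S : 𝓢(E3, Spin) →L[ℂ] L2Spin)) := by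
  obtain ⟨C, hC, h⟩ := exists_norm_mulOp_le hb
  refine ⟨C * ‖S‖, by positivity, fun f => (h _).trans ?_⟩
  rw [mul_assoc]
  gcongr
  refine (norm_emb_postcomp_le S f).trans ?_
  gcongr
  exact le_add_of_nonneg_right (by positivity)

theorem firstOrderBounded_firstOrderOp (hbar : ℝ) (j : Fin 3) {b b' : E3 → ℝ}
    (hb : MemLp b ∞) (hb' : MemLp b' ∞) (S : Matrix (Fin 2) (Fin 2) ℂ) :
    FirstOrderBounded (firstOrderOp hbar j hb hb' S) := by
  obtain ⟨C, hC, h⟩ := exists_norm_mulOp_le hb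
  obtain ⟨C', hC', h'⟩ := exists_norm_mulOp_le hb'
  refine ⟨|hbar| * (C * ‖matOp S‖ + C' * ‖matOp S‖), by positivity, fun f => ?_⟩
  rw [firstOrderOp_apply, norm_smul, norm_neg, norm_mul, Complex.norm_I, one_mul,
    Complex.norm_real, Real.norm_eq_abs, mul_assoc]
  gcongr
  rw [add_mul, lineDeriv_postcomp]
  have h1 : ‖emb (∂_{stdVec j} f)‖ ≤ ‖emb f‖ + ∑ j, ‖emb (∂_{stdVec j} f)‖ :=
    le_add_of_nonneg_of_le (norm_nonneg _) (Finset.single_le_sum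
      (f := fun j => ‖emb (∂_{stdVec j} f)‖) (fun _ _ => norm_nonneg _) (Finset.mem_univ j))
  have h2 : ‖emb f‖ ≤ ‖emb f‖ + ∑ j, ‖emb (∂_{stdVec j} f)‖ :=
    le_add_of_nonneg_right (by positivity)
  refine (norm_add_le _ _).trans (add_le_add ?_ ?_)
  · refine (h _).trans ?_
    rw [mul_assoc]
    gcongr
    exact (norm_emb_postcomp_le _ _).trans (by gcongr)
  · rw [norm_smul]
    refine (mul_le_of_le_one_left (norm_nonneg _) (by norm_num)).trans ((h' _).trans ?_)
    rw [mul_assoc]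
    gcongr
    exact (norm_emb_postcomp_le _ _).trans (by gcongr)

/-- A first order operator is small relative to the free resolvent. -/
theorem FirstOrderBounded.exists_small {V : 𝓢(E3, Spin) →ₗ[ℂ] L2Spin} (hV : FirstOrderBounded V)
    {c : ℝ} (hc : 0 < c) : ∃ μ : ℝ, 0 < μ ∧ ∀ ν : ℝ, |ν| = μ → ∀ f,
      ‖V f‖ ≤ 1 / 2 * ‖emb ((-c : ℂ) • Δ f + (Complex.I * ν) • f)‖ := by
  obtain ⟨C, hC, hV⟩ := hV
  -- The relative bound of `V` combines the estimate of `‖f‖` with those of the three derivatives,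
  -- and it vanishes as `μ → ∞`.
  have hlim : Tendsto (fun μ : ℝ => C * (μ⁻¹ + 3 * (√(c * μ))⁻¹)) atTop (𝓝 (C * (0 + 3 * 0))) := by
    refine ((tendsto_inv_atTop_zero).add (Tendsto.const_mul 3 ?_)).const_mul C
    exact tendsto_inv_atTop_zero.comp
      (Real.tendsto_sqrt_atTop.comp (tendsto_id.const_mul_atTop hc))
  have hev := hlim.eventually_le_const (u := 1 / 2) (by norm_num)
  obtain ⟨μ, h1, hμ⟩ := (hev.and (eventually_gt_atTop 0)).exists
  refine ⟨μ, hμ, fun ν hν f => ?_⟩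
  have hν0 : ν ≠ 0 := fun h => by simp [h] at hν; exact hμ.ne hν
  set X := ‖emb ((-c : ℂ) • Δ f + (Complex.I * ν) • f)‖ with hX
  have e0 : ‖emb f‖ ≤ μ⁻¹ * X := by
    rw [← div_eq_inv_mul, le_div_iff₀' hμ, ← hν]
    exact norm_le_norm_free c ν f
  have e1 : ∀ j, ‖emb (∂_{stdVec j} f)‖ ≤ (√(c * μ))⁻¹ * X := fun j => by
    rw [← div_eq_inv_mul, le_div_iff₀' (by positivity), ← hν]
    exact norm_lineDeriv_le hc hν0 f j
  calc ‖V f‖ ≤ C * (‖emb f‖ + ∑ j, ‖emb (∂_{stdVec j} f)‖) := hV f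
    _ ≤ C * (μ⁻¹ * X + ∑ _j : Fin 3, (√(c * μ))⁻¹ * X) := by
        gcongr with j
        exact e1 j
    _ = C * (μ⁻¹ + 3 * (√(c * μ))⁻¹) * X := by
        simp only [Finset.sum_const, Finset.card_univ, Fintype.card_fin, nsmul_eq_mul]
        push_cast
        ring
    _ ≤ 1 / 2 * X := by gcongr

/-- The range of `-cΔ + V + iν` on test functions is dense if `V` is small relative to the free
operator. -/
theorem dense_range_perturbed {V : 𝓢(E3, Spin) →ₗ[ℂ] L2Spin} {c ν : ℝ} (hν : ν ≠ 0)
    (hV : ∀ f, ‖V f‖ ≤ 1 / 2 * ‖emb ((-c : ℂ) • Δ f + (Complex.I * ν) • f)‖) :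
    DenseRange fun f : testSchwartz => emb ((-c : ℂ) • Δ (f : 𝓢(E3, Spin)) +
      (Complex.I * ν) • (f : 𝓢(E3, Spin))) + V f := by
  let L : 𝓢(E3, Spin) →ₗ[ℂ] L2Spin := (emb ∘L ((-c : ℂ) • laplacianCLM ℂ E3 𝓢(E3, Spin) +
    (Complex.I * ν) • ContinuousLinearMap.id ℂ _) : 𝓢(E3, Spin) →L[ℂ] L2Spin)
  have hL : ∀ f, L f = emb ((-c : ℂ) • Δ f + (Complex.I * ν) • f) := fun f => by simp [L]
  have hrange : Set.range (fun f : testSchwartz => emb ((-c : ℂ) • Δ (f : 𝓢(E3, Spin)) +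
      (Complex.I * ν) • (f : 𝓢(E3, Spin))) + V f) = (testSchwartz.map (L + V) : Set L2Spin) := by
    ext u; simp [hL]
  rw [DenseRange, hrange, Submodule.dense_iff_topologicalClosure_eq_top,
    Submodule.topologicalClosure_eq_top_iff, Submodule.eq_bot_iff]
  intro η hη
  -- Orthogonality to `(L + V) f` turns `⟨η, L f⟩` into `-⟨η, V f⟩`, which is small relative to `L
  -- f`.
  have hη' : ∀ f : testSchwartz, ‖inner ℂ η (L f)‖ ≤ 1 / 2 * ‖η‖ * ‖L f‖ := fun f => by
    have h := (Submodule.mem_orthogonal' _ _).1 hη _ (Submodule.mem_map_of_mem f.2)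
    rw [LinearMap.add_apply, inner_add_right, add_eq_zero_iff_eq_neg] at h
    rw [h, norm_neg]
    refine (norm_inner_le_norm _ _).trans ?_
    rw [mul_comm (1 / 2 : ℝ), mul_assoc, hL]
    gcongr
    exact hV f
  have hcl : IsClosed {u : L2Spin | ‖inner ℂ η u‖ ≤ 1 / 2 * ‖η‖ * ‖u‖} :=
    isClosed_le (by fun_prop) (by fun_prop)
  have hd := dense_range_free_test c hν
  -- The vectors `L f` are dense, so the inequality extends to `η` itself, giving `‖η‖² ≤ ½‖η‖²`.
  have h1 : ‖inner ℂ η η‖ ≤ 1 / 2 * ‖η‖ * ‖η‖ := by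
    refine hd.induction_on (p := fun u => ‖inner ℂ η u‖ ≤ 1 / 2 * ‖η‖ * ‖u‖) η hcl fun f => ?_
    rw [← hL]
    exact hη' f
  rw [inner_self_eq_norm_sq_to_K, norm_pow, RCLike.norm_ofReal, abs_norm] at h1
  have h2 : ‖η‖ ^ 2 ≤ 0 := by nlinarith
  exact norm_eq_zero.1 (pow_eq_zero_iff two_ne_zero |>.1 (le_antisymm h2 (sq_nonneg _)))

/-! ### Bounded coefficients -/

theorem MemWInfty.memLp_top {k : ℕ} {f : E3 → ℝ} (h : MemWInfty k f) : MemLp f ∞ := by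
  obtain ⟨g, ⟨hf, hg, hfg⟩, hgb⟩ := h 0 (Nat.zero_le k) Fin.elim0
  have : f =ᵐ[volume] g := by
    refine ae_eq_of_integral_contDiff_smul_eq hf hg fun φ hφ hφ' => ?_
    simpa [mul_comm] using hfg φ hφ hφ'
  exact hgb.ae_eq this.symm

theorem MemWInfty.locallyIntegrable {k : ℕ} {f : E3 → ℝ} (h : MemWInfty k f) :
    LocallyIntegrable f := (h 0 (Nat.zero_le k) Fin.elim0).choose_spec.1.1

theorem MemWInfty.exists_hasWeakDeriv {k : ℕ} (hk : 1 ≤ k) {f : E3 → ℝ} (h : MemWInfty k f)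
    (j : Fin 3) : ∃ g, HasWeakDeriv (fun _ : Fin 1 => j) f g ∧ MemLp g ∞ := h 1 hk _

theorem MemCbInfty.continuous {U : E3 × ℝ → ℝ} (h : MemCbInfty U) (t : ℝ) :
    Continuous fun x => U (x, t) := h.1.continuous.comp (by fun_prop)

theorem MemCbInfty.memLp_top {U : E3 × ℝ → ℝ} (h : MemCbInfty U) (t : ℝ) :
    MemLp (fun x => U (x, t)) ∞ (volume : Measure E3) := by
  obtain ⟨C, hC⟩ := h.2 0
  exact memLp_top_of_bound (h.continuous t).aestronglyMeasurable C
    (Eventually.of_forall fun x => by simpa using hC (x, t))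

/-! ### The Hamiltonian -/

/-- Bilinearity of the vector product over pairs of basis vectors splits the symbol into terms of
the form scalar times constant matrix, each at most quadratic in `p`. -/
theorem hamiltonianSymbol_eq_sum (hbar m : ℝ) (U : E3 → ℝ) (B K : E3 → Fin 3 → ℝ) :
    hamiltonianSymbol hbar m U B K =
      (∑ j, fun _ p => (((2 * m)⁻¹ * p j ^ 2 : ℝ) : ℂ) • 1) +
        ((fun r _ => (U r : ℂ) • 1) + (∑ k, fun r _ => (B r k : ℂ) • ((-hbar : ℂ) • pauli k)) +
          ∑ jl : Fin 3 × Fin 3, fun r p => ((p jl.1 : ℂ) * K r jl.2) •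
            ((hbar : ℂ) • dotPauli (crossProduct (Pi.single jl.1 1) (Pi.single jl.2 1)))) := by
  ext r p i k
  simp only [hamiltonianSymbol, dotPauli, Pi.add_apply, Matrix.add_apply,
    Matrix.smul_apply, Fintype.sum_prod_type, Fin.sum_univ_three, smul_eq_mul,
    cross_apply, Pi.sub_apply, EuclideanSpace.norm_sq_eq, Real.norm_eq_abs, sq_abs]
  simp
  ring

theorem exists_hasWeylForm_hamiltonian {hbar m T : ℝ} (hh : 0 < hbar)
    {U : E3 × ℝ → ℝ} {B K : ℝ → E3 → Fin 3 → ℝ} (hAS : FieldAssumption T U B K) {t : ℝ}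
    (ht : t ∈ Set.Icc 0 T) : ∃ V : 𝓢(E3, Spin) →ₗ[ℂ] L2Spin, FirstOrderBounded V ∧
      HasWeylForm hbar (hamiltonianSymbol hbar m (fun x => U (x, t)) (B t) (K t))
        (((-((hbar ^ 2 / (2 * m) : ℝ) : ℂ)) • (emb ∘L laplacianCLM ℂ E3 𝓢(E3, Spin) :
          𝓢(E3, Spin) →L[ℂ] L2Spin) : 𝓢(E3, Spin) →ₗ[ℂ] L2Spin) + V) := by
  have hB := fun i => (hAS.magnetic i).1 t ht
  have hK := fun i => (hAS.rashba i).1 t ht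
  choose K' hK' hK'b using fun jl : Fin 3 × Fin 3 =>
    (hK jl.2).exists_hasWeakDeriv one_le_two jl.1
  have hU := hAS.potential.memLp_top t
  refine ⟨mulOp hU ∘ₗ (emb ∘L postcompCLM (matOp 1) : 𝓢(E3, Spin) →L[ℂ] L2Spin) +
    (∑ k, mulOp (hB k).memLp_top ∘ₗ (emb ∘L postcompCLM (matOp ((-hbar : ℂ) • pauli k)) :
      𝓢(E3, Spin) →L[ℂ] L2Spin)) +
    ∑ jl : Fin 3 × Fin 3, firstOrderOp hbar jl.1 (hK jl.2).memLp_top (hK'b jl)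
      ((hbar : ℂ) • dotPauli (crossProduct (Pi.single jl.1 1) (Pi.single jl.2 1))), ?_, ?_⟩
  · exact ((firstOrderBounded_mul hU _).add
      (FirstOrderBounded.sum _ fun k => firstOrderBounded_mul _ _)).add
      (FirstOrderBounded.sum _ fun jl => firstOrderBounded_firstOrderOp _ _ _ _ _)
  · rw [hamiltonianSymbol_eq_sum]
    refine HasWeylForm.add ?_ (((hasWeylForm_mul hh hU
      (hAS.potential.continuous t).locallyIntegrable 1).add
      (HasWeylForm.sum _ fun k => hasWeylForm_mul hh _ (hB k).locallyIntegrable _)).add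
      (HasWeylForm.sum _ fun jl => hasWeylForm_firstOrderOp hh _ _ _ (hK' jl) _))
    have h := HasWeylForm.sum Finset.univ (hasWeylForm_momentum_sq hh (2 * m)⁻¹)
    convert h using 1
    ext1 f
    simp only [LinearMap.sum_apply, LinearMap.smul_apply, ContinuousLinearMap.coe_coe,
      ContinuousLinearMap.comp_apply, lineDerivOpCLM_apply, laplacianCLM_eq,
      laplacian_eq_sum_stdVec, map_sum, Finset.smul_sum]
    refine Finset.sum_congr rfl fun j _ => ?_
    congr 1
    push_cast
    ring

/-! ### Symmetry -/

theorem inner_matOp (S : Matrix (Fin 2) (Fin 2) ℂ) (hS : S.IsHermitian) (u v : Spin) :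
    inner ℂ (matOp S u) v = inner ℂ u (matOp S v) := by
  have h : star (matOp S) = matOp S := by
    rw [matOp, ← map_star]
    exact congrArg _ hS
  rw [← ContinuousLinearMap.adjoint_inner_right, ← ContinuousLinearMap.star_eq_adjoint, h]

/-- Exchanging `x` and `y` fixes the midpoint and conjugates the phase, while the Hermitian matrix
moves across the inner product. Symmetry of the operator follows without computing it. -/
theorem conj_weylIntegrand {hbar : ℝ} {a : E3 → E3 → Matrix (Fin 2) (Fin 2) ℂ}
    (ha : ∀ r p, (a r p).IsHermitian) (χ φ : E3 → Spin) (p : E3) (z : E3 × E3) :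
    starRingEnd ℂ (weylIntegrand hbar a χ φ p z) = weylIntegrand hbar a φ χ p z.swap := by
  simp only [weylIntegrand, ← matOp_apply, Prod.fst_swap, Prod.snd_swap]
  rw [map_mul, inner_conj_symm, inner_matOp _ (ha _ _), midpoint_comm, ← Complex.exp_conj]
  congr 2
  rw [← neg_sub z.1 z.2, inner_neg_left, map_mul, map_div₀, Complex.conj_I, Complex.conj_ofReal,
    Complex.conj_ofReal]
  push_cast
  ring

theorem conj_integral_weylIntegrand {hbar : ℝ} {a : E3 → E3 → Matrix (Fin 2) (Fin 2) ℂ}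
    (ha : ∀ r p, (a r p).IsHermitian) (χ φ : E3 → Spin) :
    starRingEnd ℂ (∫ p, ∫ z, weylIntegrand hbar a χ φ p z) =
      ∫ p, ∫ z, weylIntegrand hbar a φ χ p z := by
  rw [← integral_conj]
  refine integral_congr_ae (Eventually.of_forall fun p => ?_)
  simp only
  rw [← integral_conj]
  simp only [conj_weylIntegrand ha]
  exact (Measure.measurePreserving_swap (μ := (volume : Measure E3))
    (ν := (volume : Measure E3))).integral_comp MeasurableEquiv.prodComm.measurableEmbedding
    (weylIntegrand hbar a φ χ p)

theorem isHermitian_dotPauli (v : Fin 3 → ℝ) : (dotPauli v).IsHermitian := by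
  ext i k
  fin_cases i <;> fin_cases k <;>
    simp [dotPauli, pauli, Fin.sum_univ_three, Matrix.conjTranspose_apply]

theorem isHermitian_hamiltonianSymbol (hbar m : ℝ) (U : E3 → ℝ) (B K : E3 → Fin 3 → ℝ)
    (x p : E3) : (hamiltonianSymbol hbar m U B K x p).IsHermitian := by
  have hreal : ∀ (c : ℝ) {S : Matrix (Fin 2) (Fin 2) ℂ}, S.IsHermitian →
      ((c : ℂ) • S).IsHermitian := fun c S hS => by
    rw [Matrix.IsHermitian, Matrix.conjTranspose_smul, hS.eq, Complex.star_def,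
      Complex.conj_ofReal]
  exact (hreal _ Matrix.isHermitian_one).add (hreal _ (isHermitian_dotPauli _))

/-! ### Weyl operators -/

theorem inner_emb_left (χ : 𝓢(E3, Spin)) (u : L2Spin) :
    inner ℂ (emb χ) u = ∫ x, inner ℂ (χ x) (u x) := by
  rw [L2.inner_def]
  refine integral_congr_ae ?_
  filter_upwards [coeFn_emb χ] with x hx
  rw [hx]

variable {hbar : ℝ} {a : E3 → E3 → Matrix (Fin 2) (Fin 2) ℂ} {A : L2Spin →ₗ.[ℂ] L2Spin}
  {H : 𝓢(E3, Spin) →ₗ[ℂ] L2Spin}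

theorem IsWeylOperator.inner_apply (hA : IsWeylOperator hbar a A) {χ φ : 𝓢(E3, Spin)}
    (hχ : χ ∈ testSchwartz) (hφ : φ ∈ testSchwartz) (x : A.domain) (hx : (x : L2Spin) = emb φ) :
    inner ℂ (emb χ) (A x) =
      (((2 * Real.pi * hbar) ^ 3)⁻¹ : ℝ) * ∫ p, ∫ z, weylIntegrand hbar a χ φ p z := by
  rw [inner_emb_left]
  exact hA.pairing χ φ (isTestFunction_of_mem hχ) (isTestFunction_of_mem hφ) x
    (hx ▸ coeFn_emb φ)

theorem IsWeylOperator.exists_emb_eq (hA : IsWeylOperator hbar a A) (x : A.domain) :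
    ∃ f ∈ testSchwartz, emb f = x := by
  have hx : (x : L2Spin) ∈ testSubmodule := hA.domain_eq ▸ x.2
  exact (mem_testSubmodule_iff _).1 hx

theorem IsWeylOperator.isFormalAdjoint (hA : IsWeylOperator hbar a A)
    (ha : ∀ r p, (a r p).IsHermitian) : A.IsFormalAdjoint A := by
  intro x y
  obtain ⟨f, hf, hfx⟩ := hA.exists_emb_eq x
  obtain ⟨g, hg, hgy⟩ := hA.exists_emb_eq y
  rw [← inner_conj_symm, ← hgy, hA.inner_apply hg hf x hfx.symm, map_mul, Complex.conj_ofReal,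
    conj_integral_weylIntegrand ha, ← hA.inner_apply hf hg y hgy.symm, hfx]

/-- Test functions are dense, so the pairings determine the value. This gives uniqueness and
transfers the explicit form to any Weyl operator. -/
theorem IsWeylOperator.apply_eq (hA : IsWeylOperator hbar a A) (hH : HasWeylForm hbar a H)
    {φ : 𝓢(E3, Spin)} (hφ : φ ∈ testSchwartz) (x : A.domain) (hx : (x : L2Spin) = emb φ) :
    A x = H φ := by
  refine dense_testSubmodule.eq_of_inner_right ℂ fun v hv => ?_
  obtain ⟨χ, hχ, rfl⟩ := (mem_testSubmodule_iff v).1 hv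
  rw [hA.inner_apply hχ hφ x hx, (hH χ hχ φ hφ).2.2]

/-- The embedding of test functions as an isomorphism onto its range. -/
def testEquiv : testSchwartz ≃ₗ[ℂ] testSubmodule :=
  LinearEquiv.ofBijective
    (((emb : 𝓢(E3, Spin) →ₗ[ℂ] L2Spin).domRestrict testSchwartz).codRestrict testSubmodule
      fun f => (mem_testSubmodule_iff _).2 ⟨f, f.2, rfl⟩)
    ⟨fun _ _ h => Subtype.ext (emb_injective (congrArg Subtype.val h)), fun ψ => by
      obtain ⟨f, hf, h⟩ := (mem_testSubmodule_iff _).1 ψ.2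
      exact ⟨⟨f, hf⟩, Subtype.ext h⟩⟩

theorem emb_testEquiv_symm (ψ : testSubmodule) :
    emb (testEquiv.symm ψ : 𝓢(E3, Spin)) = ψ :=
  congrArg Subtype.val (testEquiv.apply_symm_apply ψ)

/-- The restriction of an operator on Schwartz functions to test functions, as an operator in
`L²(ℝ³; ℂ²)`. -/
def testOperator (H : 𝓢(E3, Spin) →ₗ[ℂ] L2Spin) : L2Spin →ₗ.[ℂ] L2Spin where
  domain := testSubmodule
  toFun := H ∘ₗ testSchwartz.subtype ∘ₗ testEquiv.symm.toLinearMap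

theorem HasWeylForm.isWeylOperator (hH : HasWeylForm hbar a H) :
    IsWeylOperator hbar a (testOperator H) := by
  have key : ∀ φ : E3 → Spin, IsTestFunction φ →
      ∃ f ∈ testSchwartz, (⇑f : E3 → Spin) = φ := fun φ hφ =>
    ⟨hφ.2.toSchwartzMap hφ.1, hφ.2, rfl⟩
  refine ⟨rfl, fun χ φ hχ hφ p => ?_, fun χ φ hχ hφ => ?_, fun χ φ hχ hφ ψ hψ => ?_⟩
  all_goals
    obtain ⟨f, hf, rfl⟩ := key χ hχ
    obtain ⟨g, hg, rfl⟩ := key φ hφ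
  · exact (hH f hf g hg).1 p
  · exact (hH f hf g hg).2.1
  · have hψ' : (ψ : L2Spin) = emb g := Lp.ext (hψ.trans (coeFn_emb g).symm)
    have h1 : testOperator H ψ = H g := by
      change H (testEquiv.symm ψ : 𝓢(E3, Spin)) = H g
      rw [emb_injective ((emb_testEquiv_symm ψ).trans hψ')]
    rw [h1, ← inner_emb_left]
    exact (hH f hf g hg).2.2

theorem HasWeylForm.existsUnique (hH : HasWeylForm hbar a H) :
    ∃! A : L2Spin →ₗ.[ℂ] L2Spin, IsWeylOperator hbar a A := by
  refine ⟨testOperator H, hH.isWeylOperator, fun A hA => ?_⟩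
  refine LinearPMap.ext (hA.domain_eq.trans rfl) fun x y hxy => ?_
  obtain ⟨f, hf, hfx⟩ := hA.exists_emb_eq ⟨x, y⟩
  rw [hA.apply_eq hH hf _ hfx.symm, hH.isWeylOperator.apply_eq hH hf _ hfx.symm]

theorem IsWeylOperator.isEssentiallySelfAdjoint (hA : IsWeylOperator hbar a A)
    (ha : ∀ r p, (a r p).IsHermitian) {c : ℝ} (hc : 0 < c) {V : 𝓢(E3, Spin) →ₗ[ℂ] L2Spin}
    (hV : FirstOrderBounded V)
    (hH : HasWeylForm hbar a ((((-(c : ℂ)) • (emb ∘L laplacianCLM ℂ E3 𝓢(E3, Spin) :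
      𝓢(E3, Spin) →L[ℂ] L2Spin) : 𝓢(E3, Spin) →ₗ[ℂ] L2Spin) + V))) :
    IsEssentiallySelfAdjoint A := by
  have hd : Dense (A.domain : Set L2Spin) := hA.domain_eq ▸ dense_testSubmodule
  have hs := hA.isFormalAdjoint ha
  obtain ⟨μ, hμ, hsmall⟩ := hV.exists_small hc
  -- The smallness of `V` depends on `|ν|` only, so one `μ` serves both signs.
  have hrange : ∀ ν : ℝ, |ν| = μ →
      DenseRange fun x : A.domain => A x + (Complex.I * ν) • (x : L2Spin) := by
    intro ν hν
    have hν0 : ν ≠ 0 := fun h => by simp [h] at hν; exact hμ.ne hν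
    refine (dense_range_perturbed hν0 (hsmall ν hν)).mono ?_
    rintro _ ⟨f, rfl⟩
    have hf : emb (f : 𝓢(E3, Spin)) ∈ A.domain := by
      rw [hA.domain_eq]
      exact (mem_testSubmodule_iff _).2 ⟨f, f.2, rfl⟩
    refine ⟨⟨_, hf⟩, ?_⟩
    simp only
    rw [hA.apply_eq hH f.2 ⟨_, hf⟩ rfl, map_add, map_smul, map_smul]
    simp only [LinearMap.add_apply, LinearMap.smul_apply, ContinuousLinearMap.coe_coe,
      ContinuousLinearMap.comp_apply, laplacianCLM_eq]
    abel
  refine ⟨hd, hs, hs.isSelfAdjoint_closure hd hμ (hrange μ (abs_of_pos hμ)) ?_⟩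
  have h := hrange (-μ) (by rw [abs_neg, abs_of_pos hμ])
  simpa [sub_eq_add_neg] using h

end Rashba

end

theorem mainTheorem8 (hbar m T : ℝ) (hhbar : 0 < hbar) (hm : 0 < m) (hT : 0 < T)
    (U : Rashba.E3 × ℝ → ℝ) (B K : ℝ → Rashba.E3 → Fin 3 → ℝ)
    (hAS : Rashba.FieldAssumption T U B K) (t : ℝ) (ht : t ∈ Set.Icc 0 T) :
    (∃! A : Rashba.L2Spin →ₗ.[ℂ] Rashba.L2Spin,
      Rashba.IsWeylOperator hbar
        (Rashba.hamiltonianSymbol hbar m (fun x => U (x, t)) (B t) (K t)) A) ∧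
    ∀ A : Rashba.L2Spin →ₗ.[ℂ] Rashba.L2Spin,
      Rashba.IsWeylOperator hbar
        (Rashba.hamiltonianSymbol hbar m (fun x => U (x, t)) (B t) (K t)) A →
      Rashba.IsEssentiallySelfAdjoint A := by
  obtain ⟨V, hV, hH⟩ := Rashba.exists_hasWeylForm_hamiltonian (m := m) hhbar hAS ht
  exact ⟨hH.existsUnique, fun A hA => hA.isEssentiallySelfAdjoint
    (Rashba.isHermitian_hamiltonianSymbol hbar m _ _ _) (by positivity) hV hH⟩
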